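/- **Conventions.** For posets, $q\le p$ means that $q$ is the stronger condition. For a cardinal $\mu$, $H_\mu$ is the set of all sets whose transitive closure has size less than $\mu$. $b\subseteq^* a$ means that $b\setminus a$ is finite. For a poset $P$, $RO(P)$ is its completion, the complete Boolean algebra of regular open subsets of $P$, into which $P$ is mapped canonically; filters on $RO(P)$ are proper. If $M$ is a model containing $P$, a condition $q\in P$ is a *master condition* for $M$ if for every dense set $D\subseteq P$ with $D\in M$, every $r\le q$ is compatible with some element of $D\cap M$. The poset $P$ is *Y-proper* if for every large enough regular cardinal $\theta$, every countable elementary submodel $M\prec H_\theta$ with $P\in M$ and every $p\in P\cap M$, there is $q\le p$ which is a master condition for $M$ and such that for every $r\le q$ there is a filter $F\in M$ on $RO(P)$ with $\{s\in RO(P)\cap M: s\ge r\}\subseteq F$. **The PID poset.** Let $X=\kappa$ be a cardinal and let $I\subseteq[X]^{\le\aleph_0}$ be a P-ideal containing all singletons: $I$ is closed under subsets and finite unions, and for every countable $J\subseteq I$ there is $a\in I$ such that $b\subseteq^* a$ for every $b\in J$. Call $Y\subseteq X$ *orthogonal to $I$* if $\mathcal P(Y)\cap I=[Y]^{<\aleph_0}$,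 and let $K$ be the $\sigma$-ideal on $X$ generated by the sets orthogonal to $I$. The *PID poset* $P$ for $\kappa, I$ consists of all finite sets $p$ of triples $\langle M,x,a\rangle$ such that - $M\prec H_{\kappa^+}$ is a countable elementary submodel, $x\in X\setminus\bigcup(K\cap M)$, and $a\in I$ satisfies $b\subseteq^* a$ for all $b\in I\cap M$; - whenever $\langle M,x,a\rangle$ and $\langle N,y,b\rangle$ are distinct elements of $p$, either $M,x,a\in N$ or $N,y,b\in M$. The ordering is: $q\le p$ if $p\subseteq q$ and, whenever $\langle M,x,a\rangle\in q\setminus p$ and $\langle N,y,b\rangle\in p$ are such that $M\in N$, then $x\in b$. **Theorem.** Let $\kappa$ be a cardinal and $I\subseteq[\kappa]^{\le\aleph_0}$ a P-ideal containing all singletons, such that $\kappa$ is not a union of countably many sets orthogonal to $I$. Then the PID poset $P$ for $\kappa, I$ is Y-proper. -/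

import Mathlib

universe u

namespace PIDForcing

open Cardinal FirstOrder

/-! ### The first-order language of set theory and elementary submodels -/

/-- The only relation symbol of the language of set theory: the binary symbol for membership. -/
inductive MemRel : ℕ → Type
  | mem : MemRel 2

/-- The first-order language of set theory, with the single binary relation symbol `∈`. -/
def setLanguage : Language := ⟨fun _ => Empty, MemRel⟩

/-- The membership symbol. -/
def memSymb : setLanguage.Relations 2 := MemRel.mem

/-- Every set `A` is regarded as the structure `(A, ∈)`. -/
instance memStructure (A : ZFSet.{u}) : setLanguage.Structure A where
  funMap := fun f _ => f.elim
  RelMap := fun r v => match r, v with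
    | MemRel.mem, v => (v 0 : ZFSet.{u}) ∈ (v 1 : ZFSet.{u})

theorem relMap_memSymb {A : ZFSet.{u}} (v : Fin 2 → A) :
    Language.Structure.RelMap memSymb v ↔ (v 0 : ZFSet.{u}) ∈ (v 1 : ZFSet.{u}) := Iff.rfl

/-- `(M, ∈)` is an elementary submodel of `(N, ∈)`. -/
def IsElementarySubmodel (M N : ZFSet.{u}) : Prop :=
  ∃ h : M ⊆ N, ∀ (n : ℕ) (φ : setLanguage.Formula (Fin n)) (v : Fin n → M),
    φ.Realize (fun i => (⟨(v i : ZFSet.{u}), h (v i).2⟩ : N)) ↔ φ.Realize v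

/-- `M` is a countable elementary submodel of `N`. -/
def IsCountableSubmodel (M N : ZFSet.{u}) : Prop :=
  (M : Set ZFSet.{u}).Countable ∧ IsElementarySubmodel M N

/-! ### The sets `H_μ` -/

/-- The transitive closure of `x` (the smallest transitive class including `x` as a subset),
as a class: all `y` with `y ∈ y₁ ∈ ⋯ ∈ yₙ ∈ x`. -/
def trClosure (x : ZFSet.{u}) : Set ZFSet.{u} :=
  {y | Relation.TransGen (fun a b : ZFSet.{u} => a ∈ b) y x}

/-- `H_μ`, the set of all sets whose transitive closure has size less than `μ`. It is carved out of
the level `μ` of the cumulative hierarchy only because it has to be a set; `mem_hSet` shows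
that this is no restriction. -/
noncomputable def hSet (μ : Cardinal.{u}) : ZFSet.{u} :=
  (ZFSet.vonNeumann μ.ord).sep fun x => #(trClosure x) < lift.{u + 1} μ

theorem exists_rank_eq (x : ZFSet.{u}) :
    ∀ o < x.rank, ∃ y ∈ trClosure x, y.rank = o := by
  induction x using ZFSet.inductionOn with
  | _ x ih =>
    intro o ho
    obtain ⟨y, hy, hoy⟩ := ZFSet.lt_rank_iff.1 ho
    rcases hoy.eq_or_lt with h | h
    · exact ⟨y, Relation.TransGen.single hy, h.symm⟩
    · obtain ⟨z, hz, hzo⟩ := ih y hy o h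
      exact ⟨z, Relation.TransGen.tail hz hy, hzo⟩

theorem mem_hSet {μ : Cardinal.{u}} {x : ZFSet.{u}} :
    x ∈ hSet μ ↔ #(trClosure x) < lift.{u + 1} μ := by
  refine ⟨fun h => (ZFSet.mem_sep.1 h).2, fun h => ZFSet.mem_sep.2 ⟨?_, h⟩⟩
  rw [ZFSet.mem_vonNeumann, lt_ord, ← lift_lt.{u, u + 1}, ← Cardinal.mk_Iio_ordinal]
  refine lt_of_le_of_lt ?_ h
  choose f hf hfr using exists_rank_eq x
  refine mk_le_of_injective (f := fun o : Set.Iio x.rank => (⟨f o.1 o.2, hf o.1 o.2⟩ : trClosure x))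
    fun a b hab => ?_
  have h1 : f a.1 a.2 = f b.1 b.2 := congrArg Subtype.val hab
  exact Subtype.ext (by rw [← hfr a.1 a.2, ← hfr b.1 b.2, h1])

/-! ### Posets, their completions, and Y-properness

A poset is given by a set `P` together with a set `R` of ordered pairs, where `pair q p ∈ R` means
`q ≤ p`, that is, `q` is the stronger condition. -/

/-- `q ≤ p` in the poset `(P, R)`. -/
def PLe (R q p : ZFSet.{u}) : Prop := ZFSet.pair q p ∈ R

/-- `R` is a partial ordering of the set `P`. -/
structure IsPoset (P R : ZFSet.{u}) : Prop where
  subset : R ⊆ ZFSet.prod P P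
  refl : ∀ p ∈ P, PLe R p p
  antisymm : ∀ p ∈ P, ∀ q ∈ P, PLe R p q → PLe R q p → p = q
  trans : ∀ p ∈ P, ∀ q ∈ P, ∀ r ∈ P, PLe R p q → PLe R q r → PLe R p r

/-- `p` and `q` have a common lower bound in `(P, R)`. -/
def Compatible (P R p q : ZFSet.{u}) : Prop := ∃ r ∈ P, PLe R r p ∧ PLe R r q

/-- `D` is a dense subset of `(P, R)`. -/
def IsDenseSubset (P R D : ZFSet.{u}) : Prop :=
  D ⊆ P ∧ ∀ p ∈ P, ∃ d ∈ D, PLe R d p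

/-- `U` is a regular open subset of `(P, R)`, in the topology whose open sets are the downward
closed sets: `U` is the interior of its closure. -/
def IsRegularOpen (P R U : ZFSet.{u}) : Prop :=
  U ⊆ P ∧ ∀ p ∈ P, p ∈ U ↔ ∀ q ∈ P, PLe R q p → ∃ r ∈ U, PLe R r q

/-- The completion `RO(P)`: the complete Boolean algebra of all regular open subsets of `(P, R)`,
ordered by inclusion. Its least element is `∅` and the meet of two elements is their intersection. -/
noncomputable def roSet (P R : ZFSet.{u}) : ZFSet.{u} := P.powerset.sep (IsRegularOpen P R)

/-- The element of `RO(P)` corresponding to the condition `p`: the interior of the closure of the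
set of all conditions below `p`. -/
noncomputable def roEmbed (P R p : ZFSet.{u}) : ZFSet.{u} :=
  P.sep fun q => ∀ q' ∈ P, PLe R q' q → Compatible P R q' p

/-- `F` is a (proper) filter on the complete Boolean algebra `RO(P)`. -/
structure IsFilterRO (P R F : ZFSet.{u}) : Prop where
  subset : F ⊆ roSet P R
  nonempty : F.Nonempty
  zero_notMem : ∅ ∉ F
  upward : ∀ U ∈ F, ∀ V ∈ roSet P R, U ⊆ V → V ∈ F
  inter : ∀ U ∈ F, ∀ V ∈ F, U ∩ V ∈ F

/-- `q` is a master (generic) condition for the model `M`: for each dense set `D ∈ M`, the set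
`D ∩ M` is predense below `q`. -/
def IsMaster (P R M q : ZFSet.{u}) : Prop :=
  ∀ D ∈ M, IsDenseSubset P R D → ∀ r ∈ P, PLe R r q → ∃ d ∈ D, d ∈ M ∧ Compatible P R d r

/-- `q` is a Y-master condition for the model `M`. -/
def IsYMaster (P R M q : ZFSet.{u}) : Prop :=
  IsMaster P R M q ∧
    ∀ r ∈ P, PLe R r q →
      ∃ F ∈ M, IsFilterRO P R F ∧ ∀ s ∈ roSet P R, s ∈ M → roEmbed P R r ⊆ s → s ∈ F

/-- The poset `(P, R)` is Y-proper: for all large enough regular `θ`, all countable elementary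
submodels `M` of `H_θ` containing the poset and all conditions `p ∈ P ∩ M`, there is
a Y-master condition `q ≤ p` for `M`. -/
def YProper (P R : ZFSet.{u}) : Prop :=
  ∃ θ₀ : Cardinal.{u}, ∀ θ : Cardinal.{u}, θ₀ ≤ θ → θ.IsRegular →
    ∀ M : ZFSet.{u}, IsCountableSubmodel M (hSet θ) → ZFSet.pair P R ∈ M →
      ∀ p ∈ P, p ∈ M → ∃ q ∈ P, PLe R q p ∧ IsYMaster P R M q

/-! ### P-ideals and the PID poset -/

/-- `b ⊆* a`: all but finitely many elements of `b` belong to `a`. -/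
def AlmostSubset (b a : ZFSet.{u}) : Prop := ((b : Set ZFSet.{u}) \ (a : Set ZFSet.{u})).Finite

/-- `I` is a P-ideal of countable subsets of `X` containing all singletons. -/
structure IsPIdeal (X I : ZFSet.{u}) : Prop where
  countable : ∀ a ∈ I, a ⊆ X ∧ (a : Set ZFSet.{u}).Countable
  singleton : ∀ x ∈ X, {x} ∈ I
  mono : ∀ a ∈ I, ∀ b, b ⊆ a → b ∈ I
  union : ∀ a ∈ I, ∀ b ∈ I, a ∪ b ∈ I
  bound : ∀ J, J ⊆ I → (J : Set ZFSet.{u}).Countable → ∃ a ∈ I, ∀ b ∈ J, AlmostSubset b a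

/-- `Y ⊆ X` is orthogonal to `I`: the subsets of `Y` in `I` are exactly the finite ones. -/
def IsOrthogonal (X I Y : ZFSet.{u}) : Prop :=
  Y ⊆ X ∧ ∀ b, b ⊆ Y → (b ∈ I ↔ (b : Set ZFSet.{u}).Finite)

/-- The σ-ideal `K` on `X` generated by the sets orthogonal to `I`. -/
noncomputable def sigmaIdeal (X I : ZFSet.{u}) : ZFSet.{u} :=
  X.powerset.sep fun Y => ∃ f : ℕ → ZFSet.{u},
    (∀ n, IsOrthogonal X I (f n)) ∧ ∀ y ∈ Y, ∃ n, y ∈ f n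

/-- The ordered triple `⟨M, x, a⟩`. -/
def triple (M x a : ZFSet.{u}) : ZFSet.{u} := ZFSet.pair (ZFSet.pair M x) a

/-- The cardinal `κ`, as a von Neumann ordinal. -/
noncomputable def cardSet (κ : Cardinal.{u}) : ZFSet.{u} := κ.ord.toZFSet

/-- The triples `⟨M, x, a⟩` that may occur in conditions of the PID poset. -/
def IsPIDTriple (κ : Cardinal.{u}) (I M x a : ZFSet.{u}) : Prop :=
  IsCountableSubmodel M (hSet (Order.succ κ)) ∧
  (x ∈ cardSet κ ∧ ∀ Y ∈ sigmaIdeal (cardSet κ) I, Y ∈ M → x ∉ Y) ∧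
  (a ∈ I ∧ ∀ b ∈ I, b ∈ M → AlmostSubset b a)

/-- `p` is a condition of the PID poset. -/
def IsPIDCondition (κ : Cardinal.{u}) (I p : ZFSet.{u}) : Prop :=
  (p : Set ZFSet.{u}).Finite ∧
  (∀ t ∈ p, ∃ M x a, t = triple M x a ∧ IsPIDTriple κ I M x a) ∧
  ∀ M x a N y b, triple M x a ∈ p → triple N y b ∈ p → triple M x a ≠ triple N y b →
    (M ∈ N ∧ x ∈ N ∧ a ∈ N) ∨ (N ∈ M ∧ y ∈ M ∧ b ∈ M)

/-- The underlying set of the PID poset; see `mem_pidSet`. -/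
noncomputable def pidSet (κ : Cardinal.{u}) (I : ZFSet.{u}) : ZFSet.{u} :=
  (ZFSet.prod (ZFSet.prod (hSet (Order.succ κ)).powerset (cardSet κ)) I).powerset.sep
    (IsPIDCondition κ I)

theorem mem_pidSet {κ : Cardinal.{u}} {I p : ZFSet.{u}} :
    p ∈ pidSet κ I ↔ IsPIDCondition κ I p := by
  refine ⟨fun h => (ZFSet.mem_sep.1 h).2, fun h => ZFSet.mem_sep.2 ⟨?_, h⟩⟩
  refine ZFSet.mem_powerset.2 fun t ht => ?_
  obtain ⟨M, x, a, rfl, hM, hx, ha⟩ := h.2.1 t ht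
  obtain ⟨hsub, -⟩ := hM.2
  exact ZFSet.pair_mem_prod.2 ⟨ZFSet.pair_mem_prod.2 ⟨ZFSet.mem_powerset.2 hsub, hx.1⟩, ha.1⟩

/-- The ordering of the PID poset: `q ≤ p` if `p ⊆ q` and `x ∈ b` whenever `⟨M, x, a⟩ ∈ q \ p` and
`⟨N, y, b⟩ ∈ p` are such that `M ∈ N`. -/
def PIDLe (q p : ZFSet.{u}) : Prop :=
  p ⊆ q ∧ ∀ M x a N y b, triple M x a ∈ q → triple M x a ∉ p → triple N y b ∈ p → M ∈ N → x ∈ b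

/-- The ordering of the PID poset as a set of pairs `(q, p)` with `q ≤ p`. -/
noncomputable def pidRel (κ : Cardinal.{u}) (I : ZFSet.{u}) : ZFSet.{u} :=
  (ZFSet.prod (pidSet κ I) (pidSet κ I)).sep fun z => ∃ q p, z = ZFSet.pair q p ∧ PIDLe q p

theorem ple_pidRel {κ : Cardinal.{u}} {I q p : ZFSet.{u}} :
    PLe (pidRel κ I) q p ↔ q ∈ pidSet κ I ∧ p ∈ pidSet κ I ∧ PIDLe q p := by
  unfold PLe pidRel
  rw [ZFSet.mem_sep, ZFSet.pair_mem_prod]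
  constructor
  · rintro ⟨⟨hq, hp⟩, q', p', h, hle⟩
    obtain ⟨rfl, rfl⟩ := ZFSet.pair_inj.1 h
    exact ⟨hq, hp, hle⟩
  · rintro ⟨hq, hp, hle⟩
    exact ⟨⟨hq, hp⟩, q, p, rfl, hle⟩

theorem isPoset_pid (κ : Cardinal.{u}) (I : ZFSet.{u}) : IsPoset (pidSet κ I) (pidRel κ I) where
  subset := ZFSet.sep_subset
  refl p hp := ple_pidRel.2 ⟨hp, hp, fun _ h => h, fun _ _ _ _ _ _ h h' => absurd h h'⟩
  antisymm p _ q _ h h' := by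
    have h1 := (ple_pidRel.1 h).2.2.1
    have h2 := (ple_pidRel.1 h').2.2.1
    exact ZFSet.ext fun z => ⟨fun hz => h2 hz, fun hz => h1 hz⟩
  trans p _ q _ r _ h h' := by
    obtain ⟨hp, hq, h1, h2⟩ := ple_pidRel.1 h
    obtain ⟨-, hr, h3, h4⟩ := ple_pidRel.1 h'
    refine ple_pidRel.2 ⟨hp, hr, fun z hz => h1 (h3 hz), ?_⟩
    intro M x a N y b hM hM' hN hMN
    by_cases hMq : triple M x a ∈ q
    · exact h4 M x a N y b hMq hM' hN hMN
    · exact h2 M x a N y b hM hMq (h3 hN) hMN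

end PIDForcing

/-!
# Y-properness of the PID poset

Let `M ≺ H_θ` be countable, with the PID poset `P` in `M`, and let `p ∈ P ∩ M`. The required
condition is `q = p ∪ {⟨M ∩ H_{κ⁺}, x, a⟩}` (`exists_ple_triple_mem`); such `x` and `a` exist
since `κ` is not a countable union of orthogonal sets and `I` is a P-ideal. What has to be
understood is how a condition `r ≤ q` is related to its trace `p₀ = r ∩ M`;
the models, points and sets of the triples in `r \ p₀` are called new.

*Unavoidable families.* Let `s ∈ M` be a set of conditions with `r ∈ s`, and let `A` be the family
of finite sets covering the points of `r' \ p₀` for some `r' ≤ p₀` in `s`. The family `A` belongs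
to `M` and contains the set of points of `r \ p₀`. Remove these points one at a time, from the
topmost model down: if `y` is the point of the top model `N` and `e` consists of the remaining
points, then `{x | e ∪ {x} ∈ A}` belongs to `N` and contains `y`, so it is not in the σ-ideal `K`,
hence it includes an infinite `b ∈ I`; that is, `e` belongs to the derivative of `A`, which is
again in `M`. At the end the empty set is in an iterated derivative of `A`. Going back, the
P-ideal property yields `b ∈ I` such that `b \ e` includes a member of `A` for every finite `e`
(`isUnavoidable_of_chain`, `IsPIdeal.isUnavoidable_of_derivedFamily`). The same can be achieved
with all new models of the conditions containing a prescribed `z ∈ H_{κ⁺}`, and the set `s` is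
then called good over `p₀` (`isGood_of_mem`). Here `K` does not have to be defined inside `M`:
only the fact that its complement consists of sets with an infinite subset in `I` is used.

*Amalgamation.* Suppose that `b` belongs to all new models of a condition `r ≤ p₀`. Then `b` is
almost included in all new sets of `r`, so there is a finite `e` for which `b \ e` is included in
all of them. A condition `r' ≤ p₀` in all new models of `r` whose new points are in `b \ e` is
compatible with `r`, and `r ∪ r'` is a common lower bound (`union_ple`). With `r' ∈ M` this shows
that `q` is a master condition (`exists_compatible`). Applied repeatedly it shows that finitely
many regular open sets that are good over `p₀` intersect (`exists_mem_of_isGood`), so they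
generate a proper filter on `RO(P)`. By elementarity some filter in `M` contains all of them, and
it contains every `s ∈ RO(P) ∩ M` above `r`, which gives Y-properness.

The model theory consists of a calculus of definable relations over `(H, ∈)`, the fact that an
elementary submodel includes its countable members (`IsElementarySubmodel.subset_of_countable`),
and the fact that `M ∩ H_{κ⁺} ≺ H_{κ⁺}` (`IsElementarySubmodel.inter`). The sets `H_{κ⁺}`, `I` and
`κ` belong to `M` since they can be read off from the poset (`containsParameters`).
-/

namespace PIDForcing

open Cardinal FirstOrder

/-! ### Definable relations and functions -/

/-- The relation `φ` between members of `H` is definable over `(H, ∈)` by a first-order formula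
whose parameters are members of `M`. The relation is given on all sets; only its restriction to `H`
matters. -/
def DefinableRel (H M : ZFSet.{u}) {n : ℕ} (φ : (Fin n → ZFSet.{u}) → Prop) : Prop :=
  ∃ ψ : setLanguage.BoundedFormula {x : H // (x : ZFSet.{u}) ∈ M} n,
    ∀ v : Fin n → H, ψ.Realize (fun c => c.1) v ↔ φ fun i => v i

/-- The closure properties of `H_μ`, for regular uncountable `μ`, that the arguments below
rely on. -/
class IsClosedUniverse (H : ZFSet.{u}) : Prop where
  trans : ∀ x ∈ H, ∀ y ∈ x, y ∈ H
  subset : ∀ x ∈ H, ∀ y, y ⊆ x → y ∈ H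
  empty : ∅ ∈ H
  insert : ∀ x ∈ H, ∀ y ∈ H, insert x y ∈ H
  countable : ∀ x, x ⊆ H → (x : Set ZFSet.{u}).Countable → x ∈ H

namespace DefinableRel

variable {H M : ZFSet.{u}} {n m : ℕ} {φ ψ : (Fin n → ZFSet.{u}) → Prop}

theorem congr (h : DefinableRel H M φ) (hφ : ∀ v, (∀ i, v i ∈ H) → (φ v ↔ ψ v)) :
    DefinableRel H M ψ := by
  obtain ⟨f, hf⟩ := h
  exact ⟨f, fun v => (hf v).trans (hφ _ fun i => (v i).2)⟩

theorem not (h : DefinableRel H M φ) : DefinableRel H M fun v => ¬ φ v := by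
  obtain ⟨f, hf⟩ := h
  exact ⟨f.not, fun v => by rw [Language.BoundedFormula.realize_not, hf]⟩

theorem imp (h : DefinableRel H M φ) (h' : DefinableRel H M ψ) :
    DefinableRel H M fun v => φ v → ψ v := by
  obtain ⟨f, hf⟩ := h
  obtain ⟨g, hg⟩ := h'
  exact ⟨f.imp g, fun v => by rw [Language.BoundedFormula.realize_imp, hf, hg]⟩

theorem and (h : DefinableRel H M φ) (h' : DefinableRel H M ψ) :
    DefinableRel H M fun v => φ v ∧ ψ v :=
  (h.imp h'.not).not.congr fun v _ => by tauto

theorem or (h : DefinableRel H M φ) (h' : DefinableRel H M ψ) :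
    DefinableRel H M fun v => φ v ∨ ψ v :=
  (h.not.imp h').congr fun v _ => by tauto

theorem iff (h : DefinableRel H M φ) (h' : DefinableRel H M ψ) :
    DefinableRel H M fun v => φ v ↔ ψ v :=
  ((h.imp h').and (h'.imp h)).congr fun v _ => by tauto

theorem const (p : Prop) : DefinableRel H M fun _ : Fin n → ZFSet.{u} => p := by
  by_cases hp : p
  · exact ⟨⊤, fun v => by simp [hp]⟩
  · exact ⟨⊥, fun v => by simp [hp]⟩

theorem all {φ : (Fin n → ZFSet.{u}) → ZFSet.{u} → Prop}
    (h : DefinableRel H M fun v : Fin (n + 1) → ZFSet.{u} =>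
      φ (fun i => v i.castSucc) (v (Fin.last n))) :
    DefinableRel H M fun v => ∀ x ∈ H, φ v x := by
  obtain ⟨f, hf⟩ := h
  refine ⟨f.all, fun v => ?_⟩
  rw [Language.BoundedFormula.realize_all]
  constructor
  · intro h x hx
    simpa using (hf _).1 (h ⟨x, hx⟩)
  · intro h a
    exact (hf _).2 (by simpa using h a a.2)

theorem ex {φ : (Fin n → ZFSet.{u}) → ZFSet.{u} → Prop}
    (h : DefinableRel H M fun v : Fin (n + 1) → ZFSet.{u} =>
      φ (fun i => v i.castSucc) (v (Fin.last n))) :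
    DefinableRel H M fun v => ∃ x ∈ H, φ v x :=
  (all (φ := fun v x => ¬ φ v x) h.not).not.congr fun v _ => by push Not; rfl

/-- Renaming of variables. -/
theorem comp (h : DefinableRel H M φ) (g : Fin n → Fin m) :
    DefinableRel H M fun v : Fin m → ZFSet.{u} => φ fun i => v (g i) := by
  obtain ⟨f, hf⟩ := h
  refine ⟨Language.BoundedFormula.relabel (n := m) (k := 0) (Sum.map id g) f.toFormula, fun v => ?_⟩
  rw [Language.BoundedFormula.realize_relabel]
  refine Iff.trans ?_ (hf fun i => v (g i))
  have := Language.BoundedFormula.realize_toFormula f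
    (Sum.elim (fun c : {x : H // (x : ZFSet.{u}) ∈ M} => c.1) fun i => v (g i))
  refine Iff.trans (iff_of_eq ?_) this
  rw [Language.Formula.Realize]
  congr 1
  · funext x
    rcases x with x | x <;> rfl
  · exact Subsingleton.elim _ _

end DefinableRel

/-- The function `t` on the members of `H` takes values in `H`, and its graph is definable over
`(H, ∈)` with parameters from `M`. -/
structure DefinableFun (H M : ZFSet.{u}) {n : ℕ} (t : (Fin n → ZFSet.{u}) → ZFSet.{u}) : Prop where
  mem : ∀ v, (∀ i, v i ∈ H) → t v ∈ H
  graph : DefinableRel H M fun v : Fin (n + 1) → ZFSet.{u} =>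
    v (Fin.last n) = t fun i => v i.castSucc

variable {H M : ZFSet.{u}} {n : ℕ}

theorem DefinableRel.mem_var (i j : Fin n) :
    DefinableRel H M fun v : Fin n → ZFSet.{u} => v i ∈ v j :=
  ⟨memSymb.boundedFormula₂ (.var (.inr i)) (.var (.inr j)), fun v => by
    rw [Language.BoundedFormula.realize_rel₂, relMap_memSymb]; rfl⟩

theorem DefinableRel.eq_var (i j : Fin n) :
    DefinableRel H M fun v : Fin n → ZFSet.{u} => v i = v j :=
  ⟨.equal (.var (.inr i)) (.var (.inr j)), fun _ => Subtype.ext_iff⟩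

theorem DefinableFun.var (i : Fin n) :
    DefinableFun H M fun v : Fin n → ZFSet.{u} => v i :=
  ⟨fun _ h => h i, DefinableRel.eq_var _ _⟩

theorem DefinableFun.const {c : ZFSet.{u}} (hc : c ∈ H) (hcM : c ∈ M) :
    DefinableFun H M fun _ : Fin n → ZFSet.{u} => c :=
  ⟨fun _ _ => hc, ⟨.equal (.var (.inr (Fin.last n))) (.var (.inl ⟨⟨c, hc⟩, hcM⟩)), fun _ =>
    Subtype.ext_iff⟩⟩

theorem DefinableFun.weaken {t : (Fin n → ZFSet.{u}) → ZFSet.{u}} (h : DefinableFun H M t) :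
    DefinableFun H M fun v : Fin (n + 1) → ZFSet.{u} => t fun i => v i.castSucc :=
  ⟨fun v hv => h.mem _ fun i => hv _,
    (h.graph.comp (Fin.lastCases (Fin.last (n + 1)) fun i => i.castSucc.castSucc)).congr
      fun v _ => by simp⟩

theorem DefinableRel.subst {φ : (Fin n → ZFSet.{u}) → ZFSet.{u} → Prop}
    {t : (Fin n → ZFSet.{u}) → ZFSet.{u}} (ht : DefinableFun H M t)
    (h : DefinableRel H M fun v : Fin (n + 1) → ZFSet.{u} =>
      φ (fun i => v i.castSucc) (v (Fin.last n))) :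
    DefinableRel H M fun v => φ v (t v) :=
  (DefinableRel.ex (φ := fun v x => x = t v ∧ φ v x) (ht.graph.and h)).congr fun v hv =>
    ⟨fun ⟨_, _, h1, h2⟩ => h1 ▸ h2, fun h => ⟨_, ht.mem v hv, rfl, h⟩⟩

section
variable {s t : (Fin n → ZFSet.{u}) → ZFSet.{u}}

theorem DefinableRel.mem (ht : DefinableFun H M t) (hs : DefinableFun H M s) :
    DefinableRel H M fun v => t v ∈ s v :=
  .subst (φ := fun v x => x ∈ s v) ht <|
    .subst (φ := fun v y => v (Fin.last n) ∈ y) hs.weaken (.mem_var _ _)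

theorem DefinableRel.eq (ht : DefinableFun H M t) (hs : DefinableFun H M s) :
    DefinableRel H M fun v => t v = s v :=
  .subst (φ := fun v x => x = s v) ht <|
    .subst (φ := fun v y => v (Fin.last n) = y) hs.weaken (.eq_var _ _)

variable [hH : IsClosedUniverse H]

theorem DefinableRel.allMem {φ : (Fin n → ZFSet.{u}) → ZFSet.{u} → Prop}
    (ht : DefinableFun H M t)
    (h : DefinableRel H M fun v : Fin (n + 1) → ZFSet.{u} =>
      φ (fun i => v i.castSucc) (v (Fin.last n))) :
    DefinableRel H M fun v => ∀ x ∈ t v, φ v x :=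
  (DefinableRel.all (φ := fun v x => x ∈ t v → φ v x)
    ((DefinableRel.mem (.var _) ht.weaken).imp h)).congr fun v hv =>
    ⟨fun h x hx => h x (hH.trans _ (ht.mem v hv) x hx) hx, fun h x _ hx => h x hx⟩

theorem DefinableRel.exMem {φ : (Fin n → ZFSet.{u}) → ZFSet.{u} → Prop}
    (ht : DefinableFun H M t)
    (h : DefinableRel H M fun v : Fin (n + 1) → ZFSet.{u} =>
      φ (fun i => v i.castSucc) (v (Fin.last n))) :
    DefinableRel H M fun v => ∃ x ∈ t v, φ v x :=
  (DefinableRel.allMem (φ := fun v x => ¬ φ v x) ht h.not).not.congr fun v _ => by push Not; rfl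

theorem DefinableRel.subset (ht : DefinableFun H M t) (hs : DefinableFun H M s) :
    DefinableRel H M fun v => t v ⊆ s v :=
  DefinableRel.allMem (φ := fun v x => x ∈ s v) ht (.mem (.var _) hs.weaken)

theorem DefinableFun.insert (ht : DefinableFun H M t) (hs : DefinableFun H M s) :
    DefinableFun H M fun v => insert (t v) (s v) := by
  refine ⟨fun v hv => hH.insert _ (ht.mem v hv) _ (hs.mem v hv), ?_⟩
  refine DefinableRel.congr (.all (φ := fun v x => x ∈ v (Fin.last n) ↔
    x = t (fun i => v i.castSucc) ∨ x ∈ s fun i => v i.castSucc)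
    (.iff (.mem (.var _) (.var _)) (.or (.eq (.var _) ht.weaken.weaken)
      (.mem (.var _) hs.weaken.weaken)))) fun v hv => ?_
  constructor
  · intro h
    ext x
    rw [ZFSet.mem_insert_iff]
    refine ⟨fun hx => (h x (hH.trans _ (hv _) _ hx)).1 hx, fun hx => (h x ?_).2 hx⟩
    rcases hx with rfl | hx
    · exact ht.mem _ fun i => hv _
    · exact hH.trans _ (hs.mem _ fun i => hv _) _ hx
  · intro h x _
    rw [h, ZFSet.mem_insert_iff]

theorem DefinableFun.empty : DefinableFun H M fun _ : Fin n → ZFSet.{u} => ∅ := by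
  refine ⟨fun _ _ => hH.empty, ?_⟩
  refine DefinableRel.congr (.all (φ := fun v x => ¬ x ∈ v (Fin.last n))
    (.not (.mem (.var _) (.var _)))) fun v hv => ?_
  rw [ZFSet.eq_empty]
  exact ⟨fun h x hx => h x (hH.trans _ (hv _) _ hx) hx, fun h x _ => h x⟩

theorem DefinableFun.singleton (ht : DefinableFun H M t) :
    DefinableFun H M fun v => {t v} := by
  simpa using ht.insert .empty

theorem DefinableFun.pair (ht : DefinableFun H M t) (hs : DefinableFun H M s) :
    DefinableFun H M fun v => ZFSet.pair (t v) (s v) :=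
  ht.singleton.insert (ht.insert hs.singleton).singleton

theorem DefinableFun.triple {r : (Fin n → ZFSet.{u}) → ZFSet.{u}} (ht : DefinableFun H M t)
    (hs : DefinableFun H M s) (hr : DefinableFun H M r) :
    DefinableFun H M fun v => triple (t v) (s v) (r v) :=
  (ht.pair hs).pair hr

end

/-! ### Finite subsets -/

/-- The set of all finite subsets of `X`. -/
noncomputable def finSubsets (X : ZFSet.{u}) : ZFSet.{u} :=
  X.powerset.sep fun e => (e : Set ZFSet.{u}).Finite

theorem mem_finSubsets {X e : ZFSet.{u}} :
    e ∈ finSubsets X ↔ e ⊆ X ∧ (e : Set ZFSet.{u}).Finite := by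
  rw [finSubsets, ZFSet.mem_sep, ZFSet.mem_powerset]

theorem insert_mem_finSubsets {X e x : ZFSet.{u}} (hx : x ∈ X) (he : e ∈ finSubsets X) :
    insert x e ∈ finSubsets X := by
  rw [mem_finSubsets] at he ⊢
  refine ⟨fun z hz => ?_, by simpa using he.2.insert x⟩
  rcases ZFSet.mem_insert_iff.1 hz with rfl | hz
  exacts [hx, he.1 hz]

theorem empty_mem_finSubsets (X : ZFSet.{u}) : ∅ ∈ finSubsets X :=
  mem_finSubsets.2 ⟨ZFSet.empty_subset _, by simp⟩

theorem finSubsets_least {X F : ZFSet.{u}} (h0 : ∅ ∈ F)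
    (h : ∀ x ∈ X, ∀ e ∈ F, insert x e ∈ F) : finSubsets X ⊆ F := by
  intro e he
  obtain ⟨heX, hfin⟩ := mem_finSubsets.1 he
  have key : ∀ s : Set ZFSet.{u}, s.Finite → s ⊆ X → ∃ e ∈ F, (e : Set ZFSet.{u}) = s := by
    intro s hs
    refine Set.Finite.induction_on s hs ?_ ?_
    · exact fun _ => ⟨∅, h0, by simp⟩
    · intro a s _ _ ih hsub
      obtain ⟨e, he, rfl⟩ := ih fun x hx => hsub (Set.mem_insert_of_mem _ hx)
      exact ⟨insert a e, h _ (hsub (Set.mem_insert _ _)) _ he, by simp⟩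
  obtain ⟨e', he', h⟩ := key _ hfin (ZFSet.coe_subset_coe.2 heX)
  rwa [← SetLike.coe_injective h]

/-- A countable set has only countably many finite subsets. -/
theorem countable_setOf_subset {X b F : ZFSet.{u}} (hF : F ⊆ finSubsets X)
    (hb : (b : Set ZFSet.{u}).Countable) : {d : F | d.1 ⊆ b}.Countable := by
  have h : {s : Set ZFSet.{u} | s.Finite ∧ s ⊆ b}.Countable :=
    Set.countable_ofPred_finite_subset hb
  refine (h.preimage (f := fun d : F => (d.1 : Set ZFSet.{u}))
    fun d d' h => Subtype.ext (SetLike.coe_injective h)).mono fun d hd => ?_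
  exact ⟨(mem_finSubsets.1 (hF d.2)).2, ZFSet.coe_subset_coe.2 hd⟩

/-! ### Elementary submodels -/

/-- The inclusion of an elementary submodel, as an elementary embedding. -/
noncomputable def IsElementarySubmodel.embedding (h : IsElementarySubmodel M H) :
    M ↪ₑ[setLanguage] H where
  toFun x := ⟨x, h.choose x.2⟩
  map_formula' _ φ x := h.choose_spec _ φ x

section
variable (hM : IsElementarySubmodel M H)
include hM

theorem IsElementarySubmodel.subset : M ⊆ H := hM.choose

/-- The Tarski–Vaught property of elementary submodels. -/
theorem IsElementarySubmodel.exists_snoc {φ : (Fin (n + 1) → ZFSet.{u}) → Prop}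
    (h : DefinableRel H M φ) (v : Fin n → M)
    (hex : ∃ x ∈ H, φ (Fin.snoc (α := fun _ => ZFSet.{u}) (fun i => v i) x)) :
    ∃ x ∈ M, φ (Fin.snoc (α := fun _ => ZFSet.{u}) (fun i => v i) x) := by
  obtain ⟨f, hf⟩ := h
  have key (w : Fin n → H) (x : H) : f.Realize (fun c => c.1) (Fin.snoc w x) ↔
      φ (Fin.snoc (α := fun _ => ZFSet.{u}) (fun i => w i) x) := by
    rw [hf]
    refine iff_of_eq (congrArg φ (funext fun i => ?_))
    refine Fin.lastCases ?_ (fun i => ?_) i <;> simp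
  obtain ⟨x, hx, hφ⟩ := hex
  have h1 : f.ex.Realize (fun c => c.1) (hM.embedding ∘ v) :=
    Language.BoundedFormula.realize_ex.2 ⟨⟨x, hx⟩, (key _ _).2 hφ⟩
  have h2 : f.ex.Realize (fun c => (⟨c.1.1, c.2⟩ : M)) v :=
    (hM.embedding.map_boundedFormula f.ex (fun c => (⟨c.1.1, c.2⟩ : M)) v).1 h1
  obtain ⟨y, hy⟩ := Language.BoundedFormula.realize_ex.1 h2
  refine ⟨y, y.2, (key (hM.embedding ∘ v) (hM.embedding y)).1 ?_⟩
  have h3 := (hM.embedding.map_boundedFormula f (fun c => (⟨c.1.1, c.2⟩ : M)) _).2 hy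
  rwa [Fin.comp_snoc] at h3

/-- A relation that is definable with parameters from an elementary submodel and holds for some
element holds for some element of the submodel. -/
theorem IsElementarySubmodel.exists_mem {φ : ZFSet.{u} → Prop}
    (h : DefinableRel H M fun v : Fin 1 → ZFSet.{u} => φ (v 0))
    (hex : ∃ x ∈ H, φ x) : ∃ x ∈ M, φ x := by
  have := hM.exists_snoc h (fun i => i.elim0) (by simpa [Fin.snoc] using hex)
  simpa [Fin.snoc] using this

theorem IsElementarySubmodel.mem_of_unique {φ : ZFSet.{u} → Prop}
    (h : DefinableRel H M fun v : Fin 1 → ZFSet.{u} => φ (v 0)) {x : ZFSet.{u}} (hx : x ∈ H)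
    (hφ : φ x) (hu : ∀ y ∈ H, φ y → y = x) : x ∈ M := by
  obtain ⟨y, hy, h1⟩ := hM.exists_mem h ⟨x, hx, hφ⟩
  rwa [← hu y (hM.subset hy) h1]

theorem IsElementarySubmodel.mem_of_fun {t : ZFSet.{u}}
    (h : DefinableFun H M fun _ : Fin 0 → ZFSet.{u} => t) : t ∈ M :=
  hM.mem_of_unique (φ := fun x => x = t) (h.graph.comp fun _ => 0)
    (h.mem (fun i => i.elim0) fun i => i.elim0) rfl fun _ _ h => h

variable [hH : IsClosedUniverse H]

theorem IsElementarySubmodel.insert_mem {x y : ZFSet.{u}} (hx : x ∈ M) (hy : y ∈ M) :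
    insert x y ∈ M :=
  hM.mem_of_fun (.insert (.const (hM.subset hx) hx) (.const (hM.subset hy) hy))

theorem IsElementarySubmodel.empty_mem : ∅ ∈ M := hM.mem_of_fun .empty

theorem IsElementarySubmodel.pair_mem {x y : ZFSet.{u}} (hx : x ∈ M) (hy : y ∈ M) :
    ZFSet.pair x y ∈ M :=
  hM.mem_of_fun (.pair (.const (hM.subset hx) hx) (.const (hM.subset hy) hy))

theorem IsElementarySubmodel.triple_mem {x y z : ZFSet.{u}} (hx : x ∈ M) (hy : y ∈ M)
    (hz : z ∈ M) : triple x y z ∈ M :=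
  hM.pair_mem (hM.pair_mem hx hy) hz

/-- Comprehension in an elementary submodel: a member of `H` that is definable as a class is
a member of the submodel. -/
theorem IsElementarySubmodel.mem_of_definable {x : ZFSet.{u}} (hx : x ∈ H)
    {φ : ZFSet.{u} → Prop} (h : DefinableRel H M fun v : Fin 2 → ZFSet.{u} => φ (v 1))
    (hφ : ∀ z ∈ H, z ∈ x ↔ φ z) : x ∈ M := by
  refine hM.mem_of_unique (φ := fun x => ∀ z ∈ H, z ∈ x ↔ φ z) (.all
    (.iff (.mem (.var _) (.var _)) h)) hx hφ fun y hy h' => ?_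
  ext z
  exact ⟨fun hz => (hφ z (hH.trans _ hy _ hz)).2 ((h' z (hH.trans _ hy _ hz)).1 hz),
    fun hz => (h' z (hH.trans _ hx _ hz)).2 ((hφ z (hH.trans _ hx _ hz)).1 hz)⟩

theorem IsElementarySubmodel.finite_mem {e : ZFSet.{u}} (he : (e : Set ZFSet.{u}).Finite)
    (hsub : e ⊆ M) : e ∈ M :=
  finSubsets_least hM.empty_mem (fun _ hx _ he => hM.insert_mem hx he)
    (mem_finSubsets.2 ⟨hsub, he⟩)

theorem IsElementarySubmodel.of_pair_mem {x y : ZFSet.{u}} (h : ZFSet.pair x y ∈ M) :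
    x ∈ M ∧ y ∈ M := by
  have hp := hM.subset h
  have h1 : ({x, y} : ZFSet.{u}) ∈ H := hH.trans _ hp _ (by simp [ZFSet.pair])
  have hx : x ∈ H := hH.trans _ h1 _ (by simp)
  have hy : y ∈ H := hH.trans _ h1 _ (by simp)
  constructor
  · refine hM.mem_of_unique (φ := fun a => ∃ b ∈ H, ZFSet.pair a b = ZFSet.pair x y)
      (.ex (.eq (.pair (.var _) (.var _)) (.const hp h))) hx ⟨y, hy, rfl⟩ ?_
    rintro a - ⟨b, -, h⟩
    exact (ZFSet.pair_inj.1 h).1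
  · refine hM.mem_of_unique (φ := fun b => ∃ a ∈ H, ZFSet.pair a b = ZFSet.pair x y)
      (.ex (.eq (.pair (.var _) (.var _)) (.const hp h))) hy ⟨x, hx, rfl⟩ ?_
    rintro a - ⟨b, -, h⟩
    exact (ZFSet.pair_inj.1 h).2

theorem IsElementarySubmodel.of_triple_mem {x y z : ZFSet.{u}} (h : triple x y z ∈ M) :
    x ∈ M ∧ y ∈ M ∧ z ∈ M :=
  ⟨(hM.of_pair_mem (hM.of_pair_mem h).1).1, (hM.of_pair_mem (hM.of_pair_mem h).1).2,
    (hM.of_pair_mem h).2⟩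

end

/-! ### Countable members and relativization -/

section
variable {H M : ZFSet.{u}} (hM : IsElementarySubmodel M H) [hH : IsClosedUniverse H]
include hM

theorem IsElementarySubmodel.mem_of_least {φ : ZFSet.{u} → Prop}
    (h : DefinableRel H M fun v : Fin 1 → ZFSet.{u} => φ (v 0)) {x : ZFSet.{u}} (hx : x ∈ H)
    (hφ : φ x) (hl : ∀ y ∈ H, φ y → x ⊆ y) : x ∈ M := by
  refine hM.mem_of_unique (φ := fun x => φ x ∧ ∀ y ∈ H, φ y → x ⊆ y)
    (h.and (.all (.imp (h.comp fun _ => 1) (.subset (.var _) (.var _))))) hx ⟨hφ, hl⟩ ?_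
  rintro y hy ⟨h1, h2⟩
  exact (h2 x hx hφ).antisymm (hl y hy h1)

omit hM in
theorem IsClosedUniverse.natCast_mem (k : ℕ) : (k : Ordinal.{u}).toZFSet ∈ H := by
  induction k with
  | zero => simpa using hH.empty
  | succ k ih => simpa using hH.insert _ ih _ ih

omit hM in
theorem mem_toZFSet_omega0 {x : ZFSet.{u}} :
    x ∈ Ordinal.omega0.{u}.toZFSet ↔ ∃ k : ℕ, (k : Ordinal.{u}).toZFSet = x := by
  rw [Ordinal.mem_toZFSet_iff]
  constructor
  · rintro ⟨a, ha, rfl⟩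
    obtain ⟨k, rfl⟩ := Ordinal.lt_omega0.1 ha
    exact ⟨k, rfl⟩
  · rintro ⟨k, rfl⟩
    exact ⟨k, Ordinal.natCast_lt_omega0 k, rfl⟩

omit hM in
theorem IsClosedUniverse.omega0_mem : Ordinal.omega0.{u}.toZFSet ∈ H := by
  refine hH.countable _ (fun x hx => ?_) ?_
  · obtain ⟨k, rfl⟩ := mem_toZFSet_omega0.1 hx
    exact natCast_mem k
  · refine (Set.countable_range fun k : ℕ => (k : Ordinal.{u}).toZFSet).mono fun x hx => ?_
    exact mem_toZFSet_omega0.1 hx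

theorem IsElementarySubmodel.natCast_mem (k : ℕ) : (k : Ordinal.{u}).toZFSet ∈ M := by
  induction k with
  | zero => simpa using hM.empty_mem
  | succ k ih => simpa using hM.insert_mem ih ih

/-- The set `ω` is definable as the least set that contains `∅` and is closed under successors. -/
theorem IsElementarySubmodel.omega0_mem : Ordinal.omega0.{u}.toZFSet ∈ M := by
  refine hM.mem_of_least (φ := fun F => ∅ ∈ F ∧ ∀ k ∈ F, insert k k ∈ F)
    (.and (.mem .empty (.var _)) (.allMem (.var _) (.mem (.insert (.var _) (.var _)) (.var _))))
    IsClosedUniverse.omega0_mem ⟨mem_toZFSet_omega0.2 ⟨0, by simp⟩, ?_⟩ ?_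
  · intro k hk
    obtain ⟨k, rfl⟩ := mem_toZFSet_omega0.1 hk
    exact mem_toZFSet_omega0.2 ⟨k + 1, by simp⟩
  · rintro F - ⟨h0, h1⟩ x hx
    obtain ⟨k, rfl⟩ := mem_toZFSet_omega0.1 hx
    induction k with
    | zero => simpa using h0
    | succ k ih => simpa using h1 _ (ih (mem_toZFSet_omega0.2 ⟨k, rfl⟩))

/-- An elementary submodel includes each of its countable members: it contains an enumeration of
such a member by the natural numbers, all of which it contains. -/
theorem IsElementarySubmodel.subset_of_countable {W : ZFSet.{u}} (hW : W ∈ M)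
    (hc : (W : Set ZFSet.{u}).Countable) : W ⊆ M := by
  intro w₀ hw₀
  have hWH := hM.subset hW
  obtain ⟨g, hg⟩ := hc.exists_eq_range ⟨w₀, hw₀⟩
  have hg' (w) : w ∈ W ↔ ∃ k, g k = w := by
    rw [← SetLike.mem_coe, hg, Set.mem_range]
  have hpair {x y : ZFSet.{u}} (hx : x ∈ H) (hy : y ∈ H) : ZFSet.pair x y ∈ H :=
    (DefinableFun.pair (n := 2) (M := M) (.var 0) (.var 1)).mem ![x, y]
      (by simp [Fin.forall_fin_two, hx, hy])
  let φ : ZFSet.{u} → Prop := fun f =>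
    (∀ w ∈ W, ∃ k ∈ Ordinal.omega0.{u}.toZFSet, ZFSet.pair k w ∈ f) ∧
      ∀ k ∈ Ordinal.omega0.{u}.toZFSet, ∀ w ∈ W, ∀ w' ∈ W,
        ZFSet.pair k w ∈ f → ZFSet.pair k w' ∈ f → w = w'
  have hφ : ∃ f ∈ H, φ f := by
    refine ⟨ZFSet.range fun k : ℕ => ZFSet.pair (k : Ordinal.{u}).toZFSet (g k), ?_, ?_, ?_⟩
    · refine hH.countable _ (fun x hx => ?_) (by simpa using Set.countable_range _)
      obtain ⟨k, rfl⟩ := ZFSet.mem_range.1 hx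
      exact hpair (IsClosedUniverse.natCast_mem k) (hH.trans _ hWH _ ((hg' _).2 ⟨k, rfl⟩))
    · intro w hw
      obtain ⟨k, rfl⟩ := (hg' _).1 hw
      exact ⟨_, mem_toZFSet_omega0.2 ⟨k, rfl⟩, ZFSet.mem_range.2 ⟨k, rfl⟩⟩
    · intro k hk w _ w' _ h h'
      obtain ⟨i, hi⟩ := ZFSet.mem_range.1 h
      obtain ⟨j, hj⟩ := ZFSet.mem_range.1 h'
      obtain ⟨hi1, rfl⟩ := ZFSet.pair_inj.1 hi
      obtain ⟨hj1, rfl⟩ := ZFSet.pair_inj.1 hj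
      have : i = j := by simpa using Ordinal.toZFSet_injective (hi1.trans hj1.symm)
      rw [this]
  obtain ⟨f, hf, h1, h2⟩ := hM.exists_mem (φ := φ)
    (.and (.allMem (.const hWH hW) (.exMem (.const IsClosedUniverse.omega0_mem hM.omega0_mem)
        (.mem (.pair (.var _) (.var _)) (.var _))))
      (.allMem (.const IsClosedUniverse.omega0_mem hM.omega0_mem) (.allMem (.const hWH hW)
        (.allMem (.const hWH hW) (.imp (.mem (.pair (.var _) (.var _)) (.var _))
          (.imp (.mem (.pair (.var _) (.var _)) (.var _)) (.eq (.var _) (.var _)))))))) hφ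
  obtain ⟨k, hk, hkw⟩ := h1 w₀ hw₀
  obtain ⟨j, rfl⟩ := mem_toZFSet_omega0.1 hk
  have hj := hM.natCast_mem j
  exact hM.mem_of_unique (φ := fun w => w ∈ W ∧ ZFSet.pair (j : Ordinal.{u}).toZFSet w ∈ f)
    (.and (.mem (.var _) (.const hWH hW)) (.mem (.pair (.const (hM.subset hj) hj) (.var _))
      (.const (hM.subset hf) hf))) (hH.trans _ hWH _ hw₀) ⟨hw₀, hkw⟩
    fun w _ h => h2 _ hk _ h.1 _ hw₀ h.2 hkw

/-- Satisfaction in a structure `(K, ∈)` with `K ∈ M` is definable over `(H, ∈)`. -/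
theorem IsElementarySubmodel.exists_definable_realize {K : ZFSet.{u}} (hK : K ∈ M) {k : ℕ}
    (χ : setLanguage.BoundedFormula Empty k) :
    ∃ φ : (Fin k → ZFSet.{u}) → Prop, DefinableRel H M φ ∧
      ∀ v : Fin k → K, φ (fun i => v i) ↔ χ.Realize default v := by
  induction χ with
  | falsum => exact ⟨_, .const False, fun v => Iff.rfl⟩
  | equal t₁ t₂ =>
    rcases t₁ with (e | i) | ⟨f, _⟩
    · exact e.elim
    · rcases t₂ with (e | j) | ⟨f, _⟩
      · exact e.elim
      · exact ⟨_, .eq_var i j, fun v => Subtype.ext_iff.symm⟩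
      · exact f.elim
    · exact f.elim
  | rel R ts =>
    cases R
    have hts (i : Fin 2) : ∃ j, ts i = Language.Term.var (Sum.inr j) := by
      rcases h : ts i with (e | i) | ⟨f, _⟩
      · exact e.elim
      · exact ⟨_, rfl⟩
      · exact f.elim
    obtain ⟨i, hi⟩ := hts 0
    obtain ⟨j, hj⟩ := hts 1
    refine ⟨_, .mem_var i j, fun v => ?_⟩
    refine Iff.symm ((relMap_memSymb (A := K) _).trans ?_)
    rw [hi, hj]
    rfl
  | imp _ _ ih₁ ih₂ =>
    obtain ⟨φ₁, h₁, h₁'⟩ := ih₁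
    obtain ⟨φ₂, h₂, h₂'⟩ := ih₂
    exact ⟨_, h₁.imp h₂, fun v => by rw [h₁', h₂']; rfl⟩
  | all _ ih =>
    rename_i k _
    obtain ⟨φ, h, h'⟩ := ih
    refine ⟨fun v => ∀ x ∈ K, φ (Fin.snoc (α := fun _ => ZFSet.{u}) v x),
      .allMem (.const (hM.subset hK) hK) (h.congr fun v _ => ?_), fun v => ?_⟩
    · exact iff_of_eq (congrArg φ (Fin.snoc_init_self v).symm)
    · rw [Language.BoundedFormula.realize_all]
      have key (x : K) : (fun i => ((Fin.snoc v x : Fin (k + 1) → K) i : ZFSet.{u})) =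
          Fin.snoc (α := fun _ => ZFSet.{u}) (fun i => (v i : ZFSet.{u})) x := by
        funext i
        refine Fin.lastCases ?_ (fun i => ?_) i <;> simp
      refine ⟨fun h x => (h' _).1 (key x ▸ h x x.2), fun h x hx => ?_⟩
      rw [← key ⟨x, hx⟩]
      exact (h' _).2 (h _)

/-- If `M ≺ H` and `K ∈ M`, then `M ∩ K ≺ K`, by the Tarski–Vaught test. -/
theorem IsElementarySubmodel.inter {K : ZFSet.{u}} (hK : K ∈ M) :
    IsElementarySubmodel (M ∩ K) K := by
  have hsub : M ∩ K ⊆ K := fun x hx => (ZFSet.mem_inter.1 hx).2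
  let f : (M ∩ K : ZFSet.{u}) ↪[setLanguage] K :=
    { toFun := fun x => ⟨x, hsub x.2⟩
      inj' := fun x y h => Subtype.ext (congrArg (fun z : K => (z : ZFSet.{u})) h)
      map_fun' := fun f => f.elim
      map_rel' := fun R v => by cases R; exact Iff.rfl }
  refine ⟨hsub, fun n φ v => f.isElementary_of_exists ?_ φ v⟩
  intro n χ v a ha
  obtain ⟨φ, hφ, hφ'⟩ := hM.exists_definable_realize hK χ
  have key (x : K) : (fun i => ((Fin.snoc (f ∘ v) x : Fin (n + 1) → K) i : ZFSet.{u})) =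
      Fin.snoc (α := fun _ => ZFSet.{u}) (fun i => (v i : ZFSet.{u})) x := by
    funext i
    refine Fin.lastCases ?_ (fun i => ?_) i
    · simp
    · simp only [Fin.snoc_castSucc]
      rfl
  have hdef : DefinableRel H M fun w : Fin (n + 1) → ZFSet.{u} => φ w ∧ w (Fin.last n) ∈ K :=
    hφ.and (.mem (.var _) (.const (hM.subset hK) hK))
  obtain ⟨b, hb, h1, h2⟩ := hM.exists_snoc hdef
    (fun i => ⟨v i, (ZFSet.mem_inter.1 (v i).2).1⟩) ⟨a, hH.trans _ (hM.subset hK) _ a.2, by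
      rw [← key]; exact (hφ' _).2 ha, by simp⟩
  simp only [Fin.snoc_last] at h2
  refine ⟨⟨b, ZFSet.mem_inter.2 ⟨hb, h2⟩⟩, (hφ' _).1 ?_⟩
  rw [key]
  exact h1

end

/-! ### The sets `H_μ` -/

theorem trClosure_eq (x : ZFSet.{u}) :
    trClosure x = (x : Set ZFSet.{u}) ∪ ⋃ y ∈ (x : Set ZFSet.{u}), trClosure y := by
  ext z
  simp only [trClosure, Set.mem_ofPred_eq, Set.mem_union, SetLike.mem_coe, Set.mem_iUnion,
    exists_prop]
  constructor
  · intro h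
    cases h with
    | single h => exact Or.inl h
    | tail h h' => exact Or.inr ⟨_, h', h⟩
  · rintro (h | ⟨y, hy, h⟩)
    · exact .single h
    · exact .tail h hy

theorem subset_trClosure (x : ZFSet.{u}) : (x : Set ZFSet.{u}) ⊆ trClosure x := by
  rw [trClosure_eq]
  exact Set.subset_union_left

theorem trClosure_subset_of_mem {x y : ZFSet.{u}} (h : y ∈ x) : trClosure y ⊆ trClosure x :=
  fun _ hz => Relation.TransGen.tail hz h

theorem trClosure_mono {x y : ZFSet.{u}} (h : y ⊆ x) : trClosure y ⊆ trClosure x := by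
  intro z hz
  cases hz with
  | single hz => exact .single (h hz)
  | tail h1 h2 => exact .tail h1 (h h2)

section
variable {μ : Cardinal.{u}}

theorem hSet_trans {x y : ZFSet.{u}} (hx : x ∈ hSet μ) (hy : y ∈ x) : y ∈ hSet μ :=
  mem_hSet.2 ((mk_le_mk_of_subset (trClosure_subset_of_mem hy)).trans_lt (mem_hSet.1 hx))

theorem hSet_subset {x y : ZFSet.{u}} (hx : x ∈ hSet μ) (hy : y ⊆ x) : y ∈ hSet μ :=
  mem_hSet.2 ((mk_le_mk_of_subset (trClosure_mono hy)).trans_lt (mem_hSet.1 hx))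

theorem mem_hSet_of_subset (hμ : μ.IsRegular) {x : ZFSet.{u}} (hx : x ⊆ hSet μ)
    (hc : #x < lift.{u + 1} μ) : x ∈ hSet μ := by
  rw [mem_hSet, trClosure_eq]
  refine (mk_union_le _ _).trans_lt (add_lt_of_lt hμ.lift.aleph0_le hc ?_)
  exact (card_biUnion_lt_iff_forall_of_isRegular hμ.lift hc).2 fun y hy => mem_hSet.1 (hx hy)

theorem isClosedUniverse_hSet (hμ : μ.IsRegular) (hμ' : ℵ₀ < μ) :
    IsClosedUniverse (hSet μ) where
  trans _ hx _ hy := hSet_trans hx hy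
  subset _ hx _ hy := hSet_subset hx hy
  empty := mem_hSet_of_subset hμ (ZFSet.empty_subset _) <| by
    simpa using hμ.pos
  insert x hx y hy := by
    refine mem_hSet_of_subset hμ (fun z hz => ?_) ?_
    · rcases ZFSet.mem_insert_iff.1 hz with rfl | hz
      · exact hx
      · exact hSet_trans hy hz
    · have h1 : #(insert x y : ZFSet.{u}) ≤ #y + 1 := by
        have := mk_insert_le (s := (y : Set ZFSet.{u})) (a := x)
        rwa [← ZFSet.coe_insert] at this
      exact h1.trans_lt (add_lt_of_lt hμ.lift.aleph0_le
        ((mk_le_mk_of_subset (subset_trClosure y)).trans_lt (mem_hSet.1 hy))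
        (one_lt_aleph0.trans_le hμ.lift.aleph0_le))
  countable x hx hc := mem_hSet_of_subset hμ hx <|
    (le_aleph0_iff_set_countable.2 hc).trans_lt (by simpa using hμ')

/-- Every set belongs to `H_θ` for all large enough `θ`. -/
theorem exists_mem_hSet (x : ZFSet.{u}) : ∃ θ₀ : Cardinal.{u}, ∀ θ, θ₀ ≤ θ → x ∈ hSet θ := by
  have hs : trClosure x ⊆ (ZFSet.vonNeumann x.rank : Set ZFSet.{u}) := by
    induction x using ZFSet.inductionOn with
    | _ x ih =>
      rw [trClosure_eq]
      rintro z (hz | hz)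
      · exact ZFSet.mem_vonNeumann.2 (ZFSet.rank_lt_of_mem hz)
      · simp only [SetLike.mem_coe, Set.mem_iUnion, exists_prop] at hz
        obtain ⟨y, hy, hz⟩ := hz
        exact ZFSet.vonNeumann_subset_of_le (ZFSet.rank_lt_of_mem hy).le (ih y hy hz)
  refine ⟨Order.succ (ZFSet.vonNeumann x.rank).card, fun θ hθ => mem_hSet.2 ?_⟩
  refine (mk_le_mk_of_subset hs).trans_lt ?_
  have := @ZFSet.cardinalMk_coe_sort (ZFSet.vonNeumann x.rank)
  refine this.trans_lt ?_
  rw [lift_lt]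
  exact (Order.lt_succ _).trans_le hθ

/-- The downward Löwenheim–Skolem theorem. -/
theorem exists_countableSubmodel {H : ZFSet.{u}} [hH : IsClosedUniverse H] {z : ZFSet.{u}}
    (hz : z ∈ H) : ∃ N, IsCountableSubmodel N H ∧ z ∈ N := by
  have hinf : Infinite H := Infinite.of_injective
    (fun k : ℕ => (⟨(k : Ordinal.{u}).toZFSet, IsClosedUniverse.natCast_mem k⟩ : H))
    fun i j h => by simpa using Ordinal.toZFSet_injective (congrArg Subtype.val h)
  have hL : Countable setLanguage.Symbols := by
    have h1 (l : ℕ) : Countable (setLanguage.Functions l) :=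
      inferInstanceAs (Countable Empty)
    have h2 (l : ℕ) : Countable (setLanguage.Relations l) :=
      have : Subsingleton (MemRel l) := ⟨fun a b => by cases a; cases b; rfl⟩
      inferInstanceAs (Countable (MemRel l))
    unfold Language.Symbols
    infer_instance
  obtain ⟨S, hzS, hS⟩ := Language.exists_elementarySubstructure_card_eq (M := H) setLanguage
    {⟨z, hz⟩} aleph0.{u + 1} le_rfl (by simp) (by
      rw [lift_aleph0, lift_le_aleph0]
      exact mk_le_aleph0) (by simp)
  have hN (x : ZFSet.{u}) : x ∈ H.sep (fun x => ∃ h : x ∈ H, (⟨x, h⟩ : H) ∈ S) ↔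
      ∃ h : x ∈ H, (⟨x, h⟩ : H) ∈ S := by
    rw [ZFSet.mem_sep]
    exact ⟨fun h => h.2, fun h => ⟨h.1, h⟩⟩
  refine ⟨H.sep fun x => ∃ h : x ∈ H, (⟨x, h⟩ : H) ∈ S, ⟨?_, ZFSet.sep_subset, ?_⟩,
    (hN z).2 ⟨hz, hzS rfl⟩⟩
  · have hS' : (S : Set H).Countable := by
      rw [← le_aleph0_iff_set_countable]
      simpa using hS.le
    refine (hS'.image Subtype.val).mono fun x hx => ?_
    obtain ⟨h, hx⟩ := (hN x).1 hx
    exact ⟨_, hx, rfl⟩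
  · intro n φ v
    have h1 : ∀ x : (H.sep fun x => ∃ h : x ∈ H, (⟨x, h⟩ : H) ∈ S : ZFSet.{u}),
        ∃ h : x.1 ∈ H, (⟨x, h⟩ : H) ∈ S := fun x => (hN x).1 x.2
    let e : (H.sep fun x => ∃ h : x ∈ H, (⟨x, h⟩ : H) ∈ S : ZFSet.{u}) ≃[setLanguage] S :=
      { toFun := fun x => ⟨⟨x, (h1 x).1⟩, (h1 x).2⟩
        invFun := fun x => ⟨x.1.1, (hN _).2 ⟨x.1.2, x.2⟩⟩
        left_inv := fun _ => rfl
        right_inv := fun _ => rfl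
        map_fun' := fun f => f.elim
        map_rel' := fun R v => by cases R; exact Iff.rfl }
    exact (S.subtype.map_formula φ (e ∘ v)).trans (e.toElementaryEmbedding.map_formula φ v)
end

/-! ### P-ideals and families of finite sets -/

theorem cardSet_mem_hSet (κ : Cardinal.{u}) : cardSet κ ∈ hSet (Order.succ κ) := by
  have h : trClosure (cardSet κ) ⊆ (cardSet κ : Set ZFSet.{u}) := by
    intro z hz
    refine Relation.TransGen.head_induction_on hz (fun h => h) fun h _ ih => ?_
    exact (ZFSet.isOrdinal_toZFSet κ.ord).mem_trans h ih
  rw [mem_hSet]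
  refine (mk_le_mk_of_subset h).trans_lt ?_
  refine (@ZFSet.cardinalMk_coe_sort (cardSet κ)).trans_lt ?_
  rw [cardSet, Ordinal.card_toZFSet, card_ord, lift_lt]
  exact Order.lt_succ κ

theorem finSubsets_mem_hSet {κ : Cardinal.{u}} (hκ : ℵ₀ ≤ κ) :
    finSubsets (cardSet κ) ∈ hSet (Order.succ κ) := by
  have hc : #(cardSet κ) = lift.{u + 1} κ := by
    rw [ZFSet.cardinalMk_coe_sort, cardSet, Ordinal.card_toZFSet, card_ord]
  have hinf : Infinite (cardSet κ) := by
    rw [infinite_iff, hc]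
    simpa using hκ
  have hH := isClosedUniverse_hSet (isRegular_succ hκ) (Order.lt_succ_of_le hκ)
  refine mem_hSet_of_subset (isRegular_succ hκ) (fun e he => ?_) ?_
  · exact hH.subset _ (cardSet_mem_hSet κ) _ (mem_finSubsets.1 he).1
  · have h1 : #(finSubsets (cardSet κ)) ≤ #(Finset (cardSet κ)) := by
      refine mk_le_of_injective (f := fun e : finSubsets (cardSet κ) =>
        ((mem_finSubsets.1 e.2).2.preimage Subtype.val_injective.injOn).toFinset) ?_
      intro e e' h
      have h2 := Set.Finite.toFinset_inj.1 h
      refine Subtype.ext (ZFSet.ext fun z => ?_)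
      constructor
      · intro hz
        have : (⟨z, (mem_finSubsets.1 e.2).1 hz⟩ : cardSet κ) ∈
          (Subtype.val ⁻¹' (e.1 : Set ZFSet.{u}) : Set (cardSet κ)) := hz
        rw [h2] at this
        exact this
      · intro hz
        have : (⟨z, (mem_finSubsets.1 e'.2).1 hz⟩ : cardSet κ) ∈
          (Subtype.val ⁻¹' (e'.1 : Set ZFSet.{u}) : Set (cardSet κ)) := hz
        rw [← h2] at this
        exact this
    rw [mk_finset_of_infinite, hc] at h1
    exact h1.trans_lt (lift_lt.2 (Order.lt_succ κ))

/-- The family `A` of finite sets is *unavoidable*: for some `b ∈ I`, every finite set is disjoint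
from some member of `A` included in `b`. -/
def IsUnavoidable (X I A : ZFSet.{u}) : Prop :=
  ∃ b ∈ I, ∀ e ∈ finSubsets X, ∃ d ∈ A, d ⊆ b ∧ ∀ x ∈ d, x ∉ e

/-- The derivative of a family `A` of finite sets: the finite sets `e` such that `e ∪ {x} ∈ A` for
all `x` in some infinite member of `I`. -/
noncomputable def derivedFamily (X I A : ZFSet.{u}) : ZFSet.{u} :=
  (finSubsets X).sep fun e => ∃ b ∈ I, b ∉ finSubsets X ∧ ∀ x ∈ b, insert x e ∈ A

section
variable {X I : ZFSet.{u}} (hI : IsPIdeal X I)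
include hI

theorem IsPIdeal.empty_mem : ∅ ∈ I := by
  obtain ⟨a, ha, -⟩ := hI.bound ∅ (ZFSet.empty_subset _) (by simp)
  exact hI.mono a ha _ (ZFSet.empty_subset _)

theorem IsPIdeal.mem_of_mem_finSubsets {e : ZFSet.{u}} (he : e ∈ finSubsets X) : e ∈ I := by
  refine finSubsets_least hI.empty_mem (fun x hx e he => ?_) he
  rw [ZFSet.insert_eq]
  exact hI.union _ (hI.singleton x hx) _ he

theorem IsPIdeal.isOrthogonal_of_finite {e : ZFSet.{u}} (he : e ∈ finSubsets X) :
    IsOrthogonal X I e := by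
  obtain ⟨h1, h2⟩ := mem_finSubsets.1 he
  refine ⟨h1, fun b hb => ⟨fun _ => h2.subset (ZFSet.coe_subset_coe.2 hb), fun h => ?_⟩⟩
  exact hI.mem_of_mem_finSubsets (mem_finSubsets.2 ⟨fun z hz => h1 (hb hz), h⟩)

/-- A set outside the σ-ideal is not orthogonal to `I`, so it includes an infinite member of `I`. -/
theorem IsPIdeal.exists_infinite_subset {Y : ZFSet.{u}} (hY : Y ⊆ X) (hYK : Y ∉ sigmaIdeal X I) :
    ∃ b ∈ I, b ∉ finSubsets X ∧ b ⊆ Y := by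
  have h1 : ¬ IsOrthogonal X I Y := fun h =>
    hYK (ZFSet.mem_sep.2 ⟨ZFSet.mem_powerset.2 hY, fun _ => Y, fun _ => h, fun _ hy => ⟨0, hy⟩⟩)
  by_contra! hcon
  refine h1 ⟨hY, fun b hb => ⟨fun hbI => ?_, fun hfin => ?_⟩⟩
  · by_contra hfin
    exact hcon b hbI (fun h => hfin (mem_finSubsets.1 h).2) hb
  · exact hI.mem_of_mem_finSubsets (mem_finSubsets.2 ⟨fun z hz => hY (hb hz), hfin⟩)

/-- If `X` is not a countable union of orthogonal sets, then countably many sets of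
the σ-ideal do not cover `X`. -/
theorem IsPIdeal.exists_notMem
    (hX : ¬ ∃ Y : ℕ → ZFSet.{u}, (∀ n, IsOrthogonal X I (Y n)) ∧
      (X : Set ZFSet.{u}) = ⋃ n, (Y n : Set ZFSet.{u}))
    {C : Set ZFSet.{u}} (hC : C.Countable) (hCK : ∀ Y ∈ C, Y ∈ sigmaIdeal X I) :
    ∃ x ∈ X, ∀ Y ∈ C, x ∉ Y := by
  by_contra! hcon
  apply hX
  have h0 := hI.isOrthogonal_of_finite (empty_mem_finSubsets X)
  rcases C.eq_empty_or_nonempty with rfl | hne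
  · refine ⟨fun _ => ∅, fun _ => h0, ?_⟩
    ext x
    simp only [SetLike.mem_coe, Set.mem_iUnion, ZFSet.notMem_empty, exists_false, iff_false]
    intro hx
    obtain ⟨Y, hY, -⟩ := hcon x hx
    exact hY
  · obtain ⟨g, rfl⟩ := hC.exists_eq_range hne
    choose f hf hf' using fun n => (ZFSet.mem_sep.1 (hCK (g n) ⟨n, rfl⟩)).2
    refine ⟨fun n => f n.unpair.1 n.unpair.2, fun n => hf _ _, ?_⟩
    ext x
    simp only [SetLike.mem_coe, Set.mem_iUnion]
    constructor
    · intro hx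
      obtain ⟨_, ⟨n, rfl⟩, hx⟩ := hcon x hx
      obtain ⟨m, hm⟩ := hf' n x hx
      exact ⟨Nat.pair n m, by simpa using hm⟩
    · rintro ⟨n, hx⟩
      exact (hf _ _).1 hx

theorem IsPIdeal.isUnavoidable_of_empty_mem {A : ZFSet.{u}} (hA : ∅ ∈ A) :
    IsUnavoidable X I A :=
  ⟨∅, hI.empty_mem, fun _ _ => ⟨∅, hA, fun _ h => h, fun _ h => (ZFSet.notMem_empty _ h).elim⟩⟩

/-- The P-ideal property, applied to the countably many infinite sets witnessing
membership of finite subsets of a countable set in the derivative. -/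
theorem IsPIdeal.isUnavoidable_of_derivedFamily {A : ZFSet.{u}}
    (h : IsUnavoidable X I (derivedFamily X I A)) : IsUnavoidable X I A := by
  obtain ⟨b, hb, hbA⟩ := h
  have h1 : ∀ d : derivedFamily X I A, ∃ c ∈ I, c ∉ finSubsets X ∧ ∀ x ∈ c, insert x d.1 ∈ A :=
    fun d => (ZFSet.mem_sep.1 d.2).2
  choose g hgI hgfin hgA using h1
  let D : Set (derivedFamily X I A) := {d | d.1 ⊆ b}
  have hD : D.Countable := countable_setOf_subset ZFSet.sep_subset (hI.countable b hb).2
  obtain ⟨a, ha, hga⟩ := hI.bound (ZFSet.range fun d : D => g d)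
    (fun x hx => by obtain ⟨d, rfl⟩ := ZFSet.mem_range.1 hx; exact hgI _)
    (by
      have := hD.to_subtype
      simpa using Set.countable_range _)
  refine ⟨a ∪ b, hI.union _ ha _ hb, fun e he => ?_⟩
  obtain ⟨d, hd, hdb, hde⟩ := hbA e he
  have h3 := hga (g ⟨d, hd⟩) (ZFSet.mem_range.2 ⟨⟨⟨d, hd⟩, hdb⟩, rfl⟩)
  obtain ⟨x, hx, hx'⟩ : ∃ x ∈ g ⟨d, hd⟩, x ∈ a ∧ x ∉ e := by
    by_contra! hcon
    refine hgfin ⟨d, hd⟩ (mem_finSubsets.2 ⟨(hI.countable _ (hgI _)).1, ?_⟩)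
    refine (h3.union (mem_finSubsets.1 he).2).subset fun x hx => ?_
    by_cases hxa : x ∈ a
    · exact Or.inr (hcon x hx hxa)
    · exact Or.inl ⟨hx, hxa⟩
  refine ⟨insert x d, hgA _ x hx, fun z hz => ?_, fun z hz => ?_⟩
  · rcases ZFSet.mem_insert_iff.1 hz with rfl | hz
    · exact ZFSet.mem_union.2 (Or.inl hx'.1)
    · exact ZFSet.mem_union.2 (Or.inr (hdb hz))
  · rcases ZFSet.mem_insert_iff.1 hz with rfl | hz
    · exact hx'.2
    · exact hde z hz

end

/-! ### The PID poset -/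

section
variable {κ : Cardinal.{u}} {I : ZFSet.{u}}

theorem triple_inj {M x a N y b : ZFSet.{u}} :
    triple M x a = triple N y b ↔ M = N ∧ x = y ∧ a = b := by
  simp [triple, and_assoc]

theorem IsPIDCondition.isPIDTriple {p M x a : ZFSet.{u}} (hp : IsPIDCondition κ I p)
    (h : triple M x a ∈ p) : IsPIDTriple κ I M x a := by
  obtain ⟨N, y, b, h1, h2⟩ := hp.2.1 _ h
  obtain ⟨rfl, rfl, rfl⟩ := triple_inj.1 h1
  exact h2

theorem IsPIDCondition.subset {p q : ZFSet.{u}} (hp : IsPIDCondition κ I p) (hq : q ⊆ p) :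
    IsPIDCondition κ I q :=
  ⟨hp.1.subset (ZFSet.coe_subset_coe.2 hq), fun t ht => hp.2.1 t (hq ht),
    fun M x a N y b h h' => hp.2.2 M x a N y b (hq h) (hq h')⟩

theorem PLe.trans {p q r : ZFSet.{u}} (h : PLe (pidRel κ I) p q) (h' : PLe (pidRel κ I) q r) :
    PLe (pidRel κ I) p r :=
  (isPoset_pid κ I).trans p (ple_pidRel.1 h).1 q (ple_pidRel.1 h).2.1 r (ple_pidRel.1 h').2.1 h h'

theorem PLe.refl {p : ZFSet.{u}} (h : p ∈ pidSet κ I) : PLe (pidRel κ I) p p :=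
  (isPoset_pid κ I).refl p h

theorem mem_roSet {P R U : ZFSet.{u}} : U ∈ roSet P R ↔ IsRegularOpen P R U := by
  rw [roSet, ZFSet.mem_sep, ZFSet.mem_powerset]
  exact ⟨fun h => h.2, fun h => ⟨h.1, h⟩⟩

theorem IsRegularOpen.mem_of_ple {U p q : ZFSet.{u}}
    (hU : IsRegularOpen (pidSet κ I) (pidRel κ I) U) (hp : p ∈ U) (h : PLe (pidRel κ I) q p) :
    q ∈ U := by
  obtain ⟨hq, hp', -⟩ := ple_pidRel.1 h
  exact (hU.2 q hq).2 fun q' hq' h' => (hU.2 p hp').1 hp q' hq' (h'.trans h)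

theorem IsRegularOpen.inter {U V : ZFSet.{u}}
    (hU : IsRegularOpen (pidSet κ I) (pidRel κ I) U)
    (hV : IsRegularOpen (pidSet κ I) (pidRel κ I) V) :
    IsRegularOpen (pidSet κ I) (pidRel κ I) (U ∩ V) := by
  refine ⟨fun p hp => hU.1 (ZFSet.mem_inter.1 hp).1,
    fun p hp => ⟨fun h q hq hqp => ?_, fun h => ?_⟩⟩
  · obtain ⟨h1, h2⟩ := ZFSet.mem_inter.1 h
    exact ⟨q, ZFSet.mem_inter.2 ⟨hU.mem_of_ple h1 hqp, hV.mem_of_ple h2 hqp⟩, PLe.refl hq⟩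
  · refine ZFSet.mem_inter.2 ⟨(hU.2 p hp).2 fun q hq hqp => ?_, (hV.2 p hp).2 fun q hq hqp => ?_⟩
    · obtain ⟨r, hr, h'⟩ := h q hq hqp
      exact ⟨r, (ZFSet.mem_inter.1 hr).1, h'⟩
    · obtain ⟨r, hr, h'⟩ := h q hq hqp
      exact ⟨r, (ZFSet.mem_inter.1 hr).2, h'⟩

theorem mem_roEmbed {r : ZFSet.{u}} (hr : r ∈ pidSet κ I) :
    r ∈ roEmbed (pidSet κ I) (pidRel κ I) r :=
  ZFSet.mem_sep.2 ⟨hr, fun q hq h => ⟨q, hq, PLe.refl hq, h⟩⟩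

section
variable [hH : IsClosedUniverse (hSet (Order.succ κ))] (hI : IsPIdeal (cardSet κ) I)
include hI

theorem IsPIdeal.mem_hSet {a : ZFSet.{u}} (ha : a ∈ I) : a ∈ hSet (Order.succ κ) :=
  hH.subset _ (cardSet_mem_hSet κ) _ (hI.countable a ha).1

theorem IsPIDTriple.mem_hSet {N y a : ZFSet.{u}} (h : IsPIDTriple κ I N y a) :
    N ∈ hSet (Order.succ κ) ∧ y ∈ hSet (Order.succ κ) ∧ a ∈ hSet (Order.succ κ) :=
  ⟨hH.countable _ h.1.2.subset h.1.1, hSet_trans (cardSet_mem_hSet κ) h.2.1.1,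
    hI.mem_hSet h.2.2.1⟩

omit hI in
theorem triple_mem_universe {H : ZFSet.{u}} [IsClosedUniverse H] {x y z : ZFSet.{u}} (hx : x ∈ H)
    (hy : y ∈ H) (hz : z ∈ H) : triple x y z ∈ H :=
  (DefinableFun.triple (n := 3) (M := H) (.var 0) (.var 1) (.var 2)).mem ![x, y, z]
    (by simp [Fin.forall_fin_succ, hx, hy, hz])

theorem mem_hSet_of_mem_pidSet {p : ZFSet.{u}} (hp : p ∈ pidSet κ I) : p ∈ hSet (Order.succ κ) := by
  have hp' := mem_pidSet.1 hp
  refine hH.countable _ (fun t ht => ?_) hp'.1.countable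
  obtain ⟨N, y, a, rfl, h⟩ := hp'.2.1 t ht
  obtain ⟨h1, h2, h3⟩ := IsPIDTriple.mem_hSet hI h
  exact triple_mem_universe h1 h2 h3

variable (hX : ¬ ∃ Y : ℕ → ZFSet.{u}, (∀ n, IsOrthogonal (cardSet κ) I (Y n)) ∧
  (cardSet κ : Set ZFSet.{u}) = ⋃ n, (Y n : Set ZFSet.{u}))
include hX

omit hH in
theorem exists_isPIDTriple {N b : ZFSet.{u}} (hN : IsCountableSubmodel N (hSet (Order.succ κ)))
    (hb : b ∈ I) : ∃ x a, IsPIDTriple κ I N x a ∧ b ⊆ a := by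
  obtain ⟨x, hx, hxN⟩ := hI.exists_notMem hX
    (C := {Y | Y ∈ sigmaIdeal (cardSet κ) I ∧ Y ∈ N}) (hN.1.mono fun _ h => h.2) fun _ h => h.1
  obtain ⟨a, ha, hab⟩ := hI.bound (I.sep (· ∈ N)) ZFSet.sep_subset
    (hN.1.mono fun _ h => (ZFSet.mem_sep.1 h).2)
  refine ⟨x, b ∪ a, ⟨hN, ⟨hx, fun Y h h' => hxN Y ⟨h, h'⟩⟩, hI.union _ hb _ ha, ?_⟩,
    fun z hz => ZFSet.mem_union.2 (Or.inl hz)⟩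
  intro c hc hcN
  refine (hab c (ZFSet.mem_sep.2 ⟨hc, hcN⟩)).subset fun z hz => ⟨hz.1, fun h => hz.2 ?_⟩
  exact ZFSet.mem_union.2 (Or.inr h)

omit hI hX hH in
theorem singleton_mem_pidSet {N x a : ZFSet.{u}} (h : IsPIDTriple κ I N x a) :
    {triple N x a} ∈ pidSet κ I := by
  refine mem_pidSet.2 ⟨by simp, fun t ht => ⟨N, x, a, ZFSet.mem_singleton.1 ht, h⟩, ?_⟩
  intro M y b M' y' b' h1 h2 hne
  exact (hne ((ZFSet.mem_singleton.1 h1).trans (ZFSet.mem_singleton.1 h2).symm)).elim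

/-- The PID poset determines `H_{κ⁺}`. -/
theorem mem_hSet_iff_exists_triple {z : ZFSet.{u}} : z ∈ hSet (Order.succ κ) ↔
    ∃ p ∈ pidSet κ I, ∃ t ∈ p, ∃ N x a, t = triple N x a ∧ z ∈ N := by
  constructor
  · intro hz
    obtain ⟨N, hN, hzN⟩ := exists_countableSubmodel hz
    obtain ⟨x, a, h, -⟩ := exists_isPIDTriple hI hX hN hI.empty_mem
    exact ⟨_, singleton_mem_pidSet h, _, ZFSet.mem_singleton.2 rfl, N, x, a, rfl, hzN⟩
  · rintro ⟨p, hp, _, ht, N, x, a, rfl, hz⟩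
    exact ((mem_pidSet.1 hp).isPIDTriple ht).1.2.subset hz

/-- The PID poset determines the ideal `I`. -/
theorem mem_ideal_iff_exists_triple {b : ZFSet.{u}} : b ∈ I ↔
    ∃ p ∈ pidSet κ I, ∃ t ∈ p, ∃ N x a, t = triple N x a ∧ b ⊆ a := by
  constructor
  · intro hb
    obtain ⟨N, hN, -⟩ := exists_countableSubmodel hH.empty
    obtain ⟨x, a, h, hba⟩ := exists_isPIDTriple hI hX hN hb
    exact ⟨_, singleton_mem_pidSet h, _, ZFSet.mem_singleton.2 rfl, N, x, a, rfl, hba⟩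
  · rintro ⟨p, hp, _, ht, N, x, a, rfl, hb⟩
    exact hI.mono _ ((mem_pidSet.1 hp).isPIDTriple ht).2.2.1 _ hb

end

/-- Amalgamation: two conditions `r` and `r'` below `p₀` are compatible if `r'` belongs to all
models of `r \ p₀` and the points of `r' \ p₀` belong to all the sets of `r \ p₀`. -/
theorem union_ple [hH : IsClosedUniverse (hSet (Order.succ κ))] {p₀ r r' : ZFSet.{u}}
    (hr : PLe (pidRel κ I) r p₀)
    (hr' : PLe (pidRel κ I) r' p₀)
    (hN : ∀ N y a, triple N y a ∈ r → triple N y a ∉ p₀ → r' ∈ N)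
    (ha : ∀ N y a N' y' a', triple N y a ∈ r → triple N y a ∉ p₀ →
      triple N' y' a' ∈ r' → triple N' y' a' ∉ p₀ → y' ∈ a) :
    PLe (pidRel κ I) (r ∪ r') r ∧ PLe (pidRel κ I) (r ∪ r') r' := by
  obtain ⟨hrP, hp₀P, hrp⟩ := ple_pidRel.1 hr
  obtain ⟨hrP', -, hrp'⟩ := ple_pidRel.1 hr'
  have hrC := mem_pidSet.1 hrP
  have hrC' := mem_pidSet.1 hrP'
  have key : ∀ N y a N' y' a', triple N y a ∈ r → triple N y a ∉ p₀ →
      triple N' y' a' ∈ r' → N' ∈ N ∧ y' ∈ N ∧ a' ∈ N := by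
    intro N y a N' y' a' h h0 h'
    have hsub := (hrC.isPIDTriple h).1
    exact hsub.2.of_triple_mem (hsub.2.subset_of_countable (hN N y a h h0) hrC'.1.countable h')
  have hU : r ∪ r' ∈ pidSet κ I := by
    refine mem_pidSet.2 ⟨by simpa using hrC.1.union hrC'.1, fun t ht => ?_, ?_⟩
    · rcases ZFSet.mem_union.1 ht with ht | ht
      exacts [hrC.2.1 t ht, hrC'.2.1 t ht]
    · intro M x a N y b h h' hne
      rcases ZFSet.mem_union.1 h with h | h <;> rcases ZFSet.mem_union.1 h' with h' | h'
      · exact hrC.2.2 _ _ _ _ _ _ h h' hne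
      · by_cases h0 : triple M x a ∈ p₀
        · exact hrC'.2.2 _ _ _ _ _ _ (hrp'.1 h0) h' hne
        · exact Or.inr (key _ _ _ _ _ _ h h0 h')
      · by_cases h0 : triple N y b ∈ p₀
        · exact hrC'.2.2 _ _ _ _ _ _ h (hrp'.1 h0) hne
        · exact Or.inl (key _ _ _ _ _ _ h' h0 h)
      · exact hrC'.2.2 _ _ _ _ _ _ h h' hne
  refine ⟨ple_pidRel.2 ⟨hU, hrP, fun z hz => ZFSet.mem_union.2 (Or.inl hz), ?_⟩,
    ple_pidRel.2 ⟨hU, hrP', fun z hz => ZFSet.mem_union.2 (Or.inr hz), ?_⟩⟩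
  · intro M x a N y b h hn h' hMN
    have h1 := (ZFSet.mem_union.1 h).resolve_left hn
    have h2 : triple M x a ∉ p₀ := fun h => hn (hrp.1 h)
    by_cases h0 : triple N y b ∈ p₀
    · exact hrp'.2 M x a N y b h1 h2 h0 hMN
    · exact ha _ _ _ _ _ _ h' h0 h1 h2
  · intro M x a N y b h hn h' hMN
    have h1 := (ZFSet.mem_union.1 h).resolve_right hn
    have h2 : triple M x a ∉ p₀ := fun h => hn (hrp'.1 h)
    exact (ZFSet.mem_asymm hMN (key _ _ _ _ _ _ h1 h2 h').1).elim

/-! ### Good sets of conditions -/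

/-- The condition `r` is below `p₀`, its new models (those of the triples in `r \ p₀`) contain
`z`, and its new points belong to `b \ e`. -/
def IsWitness (κ : Cardinal.{u}) (I p₀ z b e r : ZFSet.{u}) : Prop :=
  PLe (pidRel κ I) r p₀ ∧ ∀ N ∈ hSet (Order.succ κ), ∀ y ∈ hSet (Order.succ κ),
    ∀ a ∈ hSet (Order.succ κ), triple N y a ∈ r → ¬ triple N y a ∈ p₀ → z ∈ N ∧ y ∈ b ∧ ¬ y ∈ e

/-- A set `s` of conditions is *good* over the condition `p₀` if, for every parameter `z`, some
`b ∈ I` is such that, for every finite set `e`, there is a condition `r ≤ p₀` in `s` whose new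
models all contain `z` and whose new points all belong to `b \ e`. -/
def IsGood (κ : Cardinal.{u}) (I s p₀ : ZFSet.{u}) : Prop :=
  ∀ z ∈ hSet (Order.succ κ), ∃ b ∈ I, ∀ e ∈ finSubsets (cardSet κ), ∃ r ∈ s,
    IsWitness κ I p₀ z b e r

theorem finite_setOf_triple {r : ZFSet.{u}} (hr : (r : Set ZFSet.{u}).Finite) :
    {t : ZFSet.{u} × ZFSet.{u} × ZFSet.{u} | triple t.1 t.2.1 t.2.2 ∈ r}.Finite := by
  refine hr.preimage (f := fun t : ZFSet.{u} × ZFSet.{u} × ZFSet.{u} => triple t.1 t.2.1 t.2.2)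
    fun t _ t' _ h => ?_
  obtain ⟨h1, h2, h3⟩ := triple_inj.1 h
  exact Prod.ext h1 (Prod.ext h2 h3)

/-- If `b ∈ I` belongs to all new models of a condition `r`, then almost all elements of `b`
belong to all new sets of `r`. -/
theorem sep_exists_notMem_mem_finSubsets {p₀ r b : ZFSet.{u}} (hI : IsPIdeal (cardSet κ) I)
    (hr : r ∈ pidSet κ I) (hb : b ∈ I)
    (h : ∀ N y a, triple N y a ∈ r → triple N y a ∉ p₀ → b ∈ N) :
    b.sep (fun x => ∃ N y a, triple N y a ∈ r ∧ triple N y a ∉ p₀ ∧ x ∉ a) ∈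
      finSubsets (cardSet κ) := by
  have hrC := mem_pidSet.1 hr
  refine mem_finSubsets.2 ⟨fun x hx => (hI.countable b hb).1 (ZFSet.mem_sep.1 hx).1, ?_⟩
  refine ((finite_setOf_triple hrC.1).biUnion' (t := fun t ht =>
    {x | x ∈ b ∧ x ∉ t.2.2 ∧ triple t.1 t.2.1 t.2.2 ∉ p₀}) ?_).subset ?_
  · intro t ht
    by_cases h0 : triple t.1 t.2.1 t.2.2 ∈ p₀
    · simp [h0]
    · exact ((hrC.isPIDTriple ht).2.2.2 b hb (h _ _ _ ht h0)).subset fun x hx => ⟨hx.1, hx.2.1⟩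
  · intro x hx
    obtain ⟨hxb, N, y, a, h1, h2, h3⟩ := ZFSet.mem_sep.1 hx
    exact Set.mem_iUnion₂.2 ⟨(N, y, a), h1, hxb, h3, h2⟩

/-- Finitely many open sets that are good over `p₀` have a common element; moreover it may be chosen
so that its new models all contain a given parameter. In the induction this parameter is used to
put the witnesses for the next good set into the models of the condition already found. -/
theorem exists_mem_of_isGood [hH : IsClosedUniverse (hSet (Order.succ κ))]
    (hI : IsPIdeal (cardSet κ) I) {p₀ : ZFSet.{u}}
    (hp₀ : p₀ ∈ pidSet κ I) (l : List ZFSet.{u})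
    (hgood : ∀ s ∈ l, IsGood κ I s p₀)
    (hopen : ∀ s ∈ l, s ⊆ pidSet κ I ∧ ∀ p ∈ s, ∀ q, PLe (pidRel κ I) q p → q ∈ s)
    {z : ZFSet.{u}} (hz : z ∈ hSet (Order.succ κ)) :
    ∃ r, PLe (pidRel κ I) r p₀ ∧ (∀ s ∈ l, r ∈ s) ∧
      ∀ N y a, triple N y a ∈ r → triple N y a ∉ p₀ → z ∈ N := by
  induction l generalizing z with
  | nil => exact ⟨p₀, PLe.refl hp₀, by simp, fun _ _ _ h h' => (h' h).elim⟩
  | cons s l ih =>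
    obtain ⟨b, hb, hbs⟩ := hgood s (by simp) z hz
    choose f hfs hfw using fun e : finSubsets (cardSet κ) => hbs e.1 e.2
    have hfp := fun e => (hfw e).1
    -- Only finite subsets of the countable set `b` matter, so countably many conditions suffice.
    let D : Set (finSubsets (cardSet κ)) := {d | d.1 ⊆ b}
    have hD : D.Countable := countable_setOf_subset (fun _ h => h) (hI.countable b hb).2
    let W : ZFSet.{u} := ZFSet.range fun d : D => f d
    have hWc : (W : Set ZFSet.{u}).Countable := by
      have := hD.to_subtype
      simpa [W] using Set.countable_range _
    have hW : W ∈ hSet (Order.succ κ) := by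
      refine hH.countable _ (fun x hx => ?_) hWc
      obtain ⟨d, rfl⟩ := ZFSet.mem_range.1 hx
      exact mem_hSet_of_mem_pidSet hI (ple_pidRel.1 (hfp d)).1
    obtain ⟨r, hrp, hrl, hr⟩ := ih (fun s hs => hgood s (by simp [hs]))
      (fun s hs => hopen s (by simp [hs])) (triple_mem_universe hW (hI.mem_hSet hb) hz)
    have hrP := (ple_pidRel.1 hrp).1
    have hrN : ∀ N y a, triple N y a ∈ r → triple N y a ∉ p₀ → W ⊆ N ∧ b ∈ N ∧ z ∈ N := by
      intro N y a h h'
      have hN := ((mem_pidSet.1 hrP).isPIDTriple h).1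
      obtain ⟨h1, h2, h3⟩ := hN.2.of_triple_mem (hr N y a h h')
      exact ⟨hN.2.subset_of_countable h1 hWc, h2, h3⟩
    have he := sep_exists_notMem_mem_finSubsets (p₀ := p₀) hI hrP hb
      fun N y a h h' => (hrN N y a h h').2.1
    set e := b.sep fun x => ∃ N y a, triple N y a ∈ r ∧ triple N y a ∉ p₀ ∧ x ∉ a with he'
    have hfW : f ⟨e, he⟩ ∈ W :=
      ZFSet.mem_range.2 ⟨⟨⟨e, he⟩, show e ⊆ b from ZFSet.sep_subset⟩, rfl⟩
    have hfN : ∀ N y a, triple N y a ∈ f ⟨e, he⟩ → triple N y a ∉ p₀ → z ∈ N ∧ y ∈ b ∧ y ∉ e := by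
      intro N y a h h'
      obtain ⟨h1, h2, h3⟩ := IsPIDTriple.mem_hSet hI
        ((mem_pidSet.1 (ple_pidRel.1 (hfp _)).1).isPIDTriple h)
      exact (hfw _).2 N h1 y h2 a h3 h h'
    obtain ⟨hu1, hu2⟩ := union_ple hrp (hfp ⟨e, he⟩)
        (fun N y a h h' => (hrN N y a h h').1 hfW) <| by
      intro N y a N' y' a' h1 h2 h3 h4
      obtain ⟨-, h5, h6⟩ := hfN _ _ _ h3 h4
      by_contra h7
      exact h6 (ZFSet.mem_sep.2 ⟨h5, N, y, a, h1, h2, h7⟩)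
    refine ⟨r ∪ f ⟨e, he⟩, hu1.trans hrp, ?_, ?_⟩
    · intro t ht
      rcases List.mem_cons.1 ht with rfl | ht'
      · exact (hopen t (by simp)).2 _ (hfs _) _ hu2
      · exact (hopen t ht).2 _ (hrl t ht') _ hu1
    · intro N y a h h'
      rcases ZFSet.mem_union.1 h with h | h
      · exact (hrN N y a h h').2.2
      · exact (hfN N y a h h').1

end

/-! ### Elementary submodels containing the PID poset -/

/-- The set `M` contains the objects from which the notions used below are defined. -/
structure ContainsParameters (κ : Cardinal.{u}) (I M : ZFSet.{u}) : Prop where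
  hSet_mem : hSet (Order.succ κ) ∈ M
  ideal_mem : I ∈ M
  cardSet_mem : cardSet κ ∈ M
  finSubsets_mem : finSubsets (cardSet κ) ∈ M
  pidSet_mem : pidSet κ I ∈ M
  pidRel_mem : pidRel κ I ∈ M
  roSet_mem : roSet (pidSet κ I) (pidRel κ I) ∈ M

theorem IsElementarySubmodel.const {H M c : ZFSet.{u}} {n : ℕ} (hM : IsElementarySubmodel M H)
    (hc : c ∈ M) : DefinableFun H M fun _ : Fin n → ZFSet.{u} => c :=
  .const (hM.subset hc) hc

section
variable {κ : Cardinal.{u}} {I H M : ZFSet.{u}} [hH : IsClosedUniverse H]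

/-- An elementary submodel containing the PID poset contains all the parameters: `H_{κ⁺}` is the
union of the models in the triples, `I` is generated by the sets in the triples, and `κ` is the union
of `I`. -/
theorem containsParameters [IsClosedUniverse (hSet (Order.succ κ))] (hκ : ℵ₀ ≤ κ)
    (hM : IsElementarySubmodel M H)
    (hI : IsPIdeal (cardSet κ) I)
    (hX : ¬ ∃ Y : ℕ → ZFSet.{u}, (∀ n, IsOrthogonal (cardSet κ) I (Y n)) ∧
      (cardSet κ : Set ZFSet.{u}) = ⋃ n, (Y n : Set ZFSet.{u}))
    (hbig : (hSet (Order.succ κ)).powerset ∈ H)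
    (hPR : ZFSet.pair (pidSet κ I) (pidRel κ I) ∈ M) : ContainsParameters κ I M := by
  obtain ⟨hP, hR⟩ := hM.of_pair_mem hPR
  have hKH : hSet (Order.succ κ) ∈ H :=
    hH.trans _ hbig _ (ZFSet.mem_powerset.2 fun _ h => h)
  have hKsub {z : ZFSet.{u}} (hz : z ∈ hSet (Order.succ κ)) : z ∈ H := hH.trans _ hKH _ hz
  have htriple {p N x a : ZFSet.{u}} (hp : p ∈ pidSet κ I) (h : triple N x a ∈ p) :
      N ∈ H ∧ x ∈ H ∧ a ∈ H := by
    obtain ⟨h1, h2, h3⟩ := IsPIDTriple.mem_hSet hI ((mem_pidSet.1 hp).isPIDTriple h)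
    exact ⟨hKsub h1, hKsub h2, hKsub h3⟩
  have hIM : I ∈ M := by
    refine hM.mem_of_definable (hH.subset _ hKH _ fun _ h => hI.mem_hSet h)
      (φ := fun z => ∃ p ∈ pidSet κ I, ∃ t ∈ p, ∃ N ∈ H, ∃ x ∈ H, ∃ a ∈ H,
        t = triple N x a ∧ z ⊆ a)
      (.exMem (hM.const hP) (.exMem (.var _) (.ex (.ex (.ex (.and
        (.eq (.var _) (.triple (.var _) (.var _) (.var _))) (.subset (.var _) (.var _)))))))) ?_
    intro z _
    rw [mem_ideal_iff_exists_triple hI hX]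
    constructor
    · rintro ⟨p, hp, _, ht, N, x, a, rfl, h⟩
      obtain ⟨h1, h2, h3⟩ := htriple hp ht
      exact ⟨p, hp, _, ht, N, h1, x, h2, a, h3, rfl, h⟩
    · rintro ⟨p, hp, _, ht, N, -, x, -, a, -, rfl, h⟩
      exact ⟨p, hp, _, ht, N, x, a, rfl, h⟩
  have hκM : cardSet κ ∈ M := by
    refine hM.mem_of_definable (hKsub (cardSet_mem_hSet κ)) (φ := fun z => {z} ∈ I)
      (.mem (.singleton (.var _)) (hM.const hIM)) fun z _ => ⟨hI.singleton z, fun h => ?_⟩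
    exact (hI.countable _ h).1 (ZFSet.mem_singleton.2 rfl)
  refine ⟨?_, hIM, hκM, ?_, hP, hR, ?_⟩
  · refine hM.mem_of_definable hKH (φ := fun z => ∃ p ∈ pidSet κ I, ∃ t ∈ p,
        ∃ N ∈ H, ∃ x ∈ H, ∃ a ∈ H, t = triple N x a ∧ z ∈ N)
      (.exMem (hM.const hP) (.exMem (.var _) (.ex (.ex (.ex (.and
        (.eq (.var _) (.triple (.var _) (.var _) (.var _))) (.mem (.var _) (.var _)))))))) ?_
    intro z _
    rw [mem_hSet_iff_exists_triple hI hX]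
    constructor
    · rintro ⟨p, hp, _, ht, N, x, a, rfl, h⟩
      obtain ⟨h1, h2, h3⟩ := htriple hp ht
      exact ⟨p, hp, _, ht, N, h1, x, h2, a, h3, rfl, h⟩
    · rintro ⟨p, hp, _, ht, N, -, x, -, a, -, rfl, h⟩
      exact ⟨p, hp, _, ht, N, x, a, rfl, h⟩
  · refine hM.mem_of_least (φ := fun F => ∅ ∈ F ∧ ∀ x ∈ cardSet κ, ∀ e ∈ F, insert x e ∈ F)
      (.and (.mem .empty (.var _)) (.allMem (hM.const hκM) (.allMem (.var _)
        (.mem (.insert (.var _) (.var _)) (.var _))))) (hKsub (finSubsets_mem_hSet hκ))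
      ⟨empty_mem_finSubsets _, fun x hx e he => insert_mem_finSubsets hx he⟩
      fun F _ h => finSubsets_least h.1 h.2
  · refine hM.mem_of_definable (hH.subset _ hbig _ ?_)
      (φ := fun U => IsRegularOpen (pidSet κ I) (pidRel κ I) U)
      (.and (.subset (.var _) (hM.const hP)) (.allMem (hM.const hP) (.iff (.mem (.var _) (.var _))
        (.allMem (hM.const hP) (.imp (.mem (.pair (.var _) (.var _)) (hM.const hR))
          (.exMem (.var _) (.mem (.pair (.var _) (.var _)) (hM.const hR)))))))) ?_
    · intro U hU
      exact ZFSet.mem_powerset.2 fun p hp =>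
        mem_hSet_of_mem_pidSet hI ((mem_roSet.1 hU).1 hp)
    · exact fun U _ => mem_roSet

theorem ContainsParameters.derivedFamily_mem (hc : ContainsParameters κ I M)
    (hM : IsElementarySubmodel M H) {A : ZFSet.{u}} (hA : A ∈ M) :
    derivedFamily (cardSet κ) I A ∈ M := by
  refine hM.mem_of_definable (hH.subset _ (hM.subset hc.finSubsets_mem) _ ZFSet.sep_subset)
    (φ := fun e => e ∈ finSubsets (cardSet κ) ∧
      ∃ b ∈ I, ¬ b ∈ finSubsets (cardSet κ) ∧ ∀ x ∈ b, insert x e ∈ A)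
    (.and (.mem (.var _) (hM.const hc.finSubsets_mem)) (.exMem (hM.const hc.ideal_mem)
      (.and (.not (.mem (.var _) (hM.const hc.finSubsets_mem))) (.allMem (.var _)
        (.mem (.insert (.var _) (.var _)) (hM.const hA)))))) fun e _ => ?_
  rw [derivedFamily, ZFSet.mem_sep]

theorem ContainsParameters.isWitness (hc : ContainsParameters κ I M)
    (hM : IsElementarySubmodel M H) {n : ℕ} {p₀ z b e r : (Fin n → ZFSet.{u}) → ZFSet.{u}}
    (hp₀ : DefinableFun H M p₀) (hz : DefinableFun H M z) (hb : DefinableFun H M b)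
    (he : DefinableFun H M e) (hr : DefinableFun H M r) :
    DefinableRel H M fun v => IsWitness κ I (p₀ v) (z v) (b v) (e v) (r v) :=
  .and (.mem (.pair hr hp₀) (hM.const hc.pidRel_mem)) (.allMem (hM.const hc.hSet_mem)
    (.allMem (hM.const hc.hSet_mem) (.allMem (hM.const hc.hSet_mem) (.imp
      (.mem (.triple (.var _) (.var _) (.var _)) hr.weaken.weaken.weaken) (.imp
        (.not (.mem (.triple (.var _) (.var _) (.var _)) hp₀.weaken.weaken.weaken))
        (.and (.mem hz.weaken.weaken.weaken (.var _)) (.and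
          (.mem (.var _) hb.weaken.weaken.weaken)
          (.not (.mem (.var _) he.weaken.weaken.weaken)))))))))

/-- The family of all finite sets that include the set of new points of some condition in `s` whose
new models contain `z`. -/
noncomputable def traceFamily (κ : Cardinal.{u}) (I s p₀ z : ZFSet.{u}) : ZFSet.{u} :=
  (finSubsets (cardSet κ)).sep fun d => ∃ r ∈ s, IsWitness κ I p₀ z d ∅ r

theorem ContainsParameters.traceFamily_mem (hc : ContainsParameters κ I M)
    (hM : IsElementarySubmodel M H) {s p₀ z : ZFSet.{u}} (hs : s ∈ M) (hp₀ : p₀ ∈ M) (hz : z ∈ M) :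
    traceFamily κ I s p₀ z ∈ M := by
  refine hM.mem_of_definable (hH.subset _ (hM.subset hc.finSubsets_mem) _ ZFSet.sep_subset)
    (φ := fun d => d ∈ finSubsets (cardSet κ) ∧ ∃ r ∈ s, IsWitness κ I p₀ z d ∅ r)
    (.and (.mem (.var _) (hM.const hc.finSubsets_mem)) (.exMem (hM.const hs)
      (hc.isWitness hM (hM.const hp₀) (hM.const hz) (.var _) .empty (.var _)))) fun e _ => ?_
  rw [traceFamily, ZFSet.mem_sep]

variable [hK : IsClosedUniverse (hSet (Order.succ κ))]

/-- A family `A ∈ M` of finite sets is unavoidable if it contains the set of points of a finite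
chain of models above `M`. The proof removes the pairs from the top: for the top pair
`(N, y)`, the set of all `x` with `e ∪ {x} ∈ A`, where `e` consists of the other points, belongs to
`N` and contains `y`, so it is not in the σ-ideal and `e` belongs to the derivative of `A`. -/
theorem isUnavoidable_of_chain (hκ : ℵ₀ ≤ κ) (hc : ContainsParameters κ I M)
    (hM : IsElementarySubmodel M H) (hI : IsPIdeal (cardSet κ) I)
    (Q : Finset (ZFSet.{u} × ZFSet.{u}))
    (hQ : ∀ t ∈ Q, IsCountableSubmodel t.1 (hSet (Order.succ κ)) ∧
      (∀ Y ∈ sigmaIdeal (cardSet κ) I, Y ∈ t.1 → t.2 ∉ Y) ∧ M ∩ hSet (Order.succ κ) ⊆ t.1)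
    (hlin : ∀ t ∈ Q, ∀ t' ∈ Q, t ≠ t' → (t.1 ∈ t'.1 ∧ t.2 ∈ t'.1) ∨ (t'.1 ∈ t.1 ∧ t'.2 ∈ t.1))
    {A e : ZFSet.{u}} (hA : A ∈ M) (hAfin : A ⊆ finSubsets (cardSet κ)) (he : e ∈ A)
    (heQ : ∀ y, y ∈ e ↔ ∃ t ∈ Q, t.2 = y) : IsUnavoidable (cardSet κ) I A := by
  classical
  induction Q using Finset.induction_on_max_value
    (fun t : ZFSet.{u} × ZFSet.{u} => t.1.rank) generalizing A e with
  | empty =>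
    have : e = ∅ := (ZFSet.eq_empty e).2 fun y hy => by simpa using (heQ y).1 hy
    exact hI.isUnavoidable_of_empty_mem (this ▸ he)
  | insert t Q htQ hmax ih =>
    obtain ⟨N, y⟩ := t
    obtain ⟨hN, hy, hMN⟩ := hQ (N, y) (Finset.mem_insert_self _ _)
    have hefin := mem_finSubsets.1 (hAfin he)
    let d : ZFSet.{u} := e.sep fun x => ∃ t ∈ Q, t.2 = x
    have hdQ (x : ZFSet.{u}) : x ∈ d ↔ ∃ t ∈ Q, t.2 = x := by
      refine ZFSet.mem_sep.trans ⟨fun h => h.2, fun h => ⟨(heQ x).2 ?_, h⟩⟩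
      obtain ⟨t, ht, h⟩ := h
      exact ⟨t, Finset.mem_insert_of_mem ht, h⟩
    have hed : insert y d = e := by
      ext x
      rw [ZFSet.mem_insert_iff, hdQ, heQ, Finset.exists_mem_insert, eq_comm]
    have hdfin : d ∈ finSubsets (cardSet κ) := mem_finSubsets.2
      ⟨fun x hx => hefin.1 (ZFSet.mem_sep.1 hx).1,
        hefin.2.subset fun x hx => (ZFSet.mem_sep.1 hx).1⟩
    have hdN : d ∈ N := by
      refine hN.2.finite_mem (mem_finSubsets.1 hdfin).2 fun x hx => ?_
      obtain ⟨t, ht, rfl⟩ := (hdQ x).1 hx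
      rcases hlin t (Finset.mem_insert_of_mem ht) (N, y) (Finset.mem_insert_self _ _)
        (fun h => htQ (h ▸ ht)) with h | h
      · exact h.2
      · exact absurd (hmax t ht) (not_le.2 (ZFSet.rank_lt_of_mem h.1))
    have hAN : A ∈ N := hMN (ZFSet.mem_inter.2 ⟨hA, hK.subset _ (finSubsets_mem_hSet hκ) _ hAfin⟩)
    let Y : ZFSet.{u} := (cardSet κ).sep fun x => insert x d ∈ A
    have hYN : Y ∈ N := by
      refine hN.2.mem_of_definable (hK.subset _ (cardSet_mem_hSet κ) _ ZFSet.sep_subset)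
        (φ := fun x => insert x d ∈ A)
        (.mem (.insert (.var _) (hN.2.const hdN)) (hN.2.const hAN)) fun x _ => ?_
      refine ZFSet.mem_sep.trans ⟨fun h => h.2, fun h => ⟨?_, h⟩⟩
      exact (mem_finSubsets.1 (hAfin h)).1 (ZFSet.mem_insert _ _)
    have hyY : y ∈ Y := by
      refine ZFSet.mem_sep.2 ⟨hefin.1 ?_, hed ▸ he⟩
      rw [← hed]
      exact ZFSet.mem_insert _ _
    obtain ⟨b, hb, hbfin, hbY⟩ := hI.exists_infinite_subset (Y := Y) ZFSet.sep_subset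
      fun h => hy Y h hYN hyY
    refine hI.isUnavoidable_of_derivedFamily (ih (fun t ht => hQ t (Finset.mem_insert_of_mem ht))
      (fun t ht t' ht' => hlin t (Finset.mem_insert_of_mem ht) t' (Finset.mem_insert_of_mem ht'))
      (hc.derivedFamily_mem hM hA) ZFSet.sep_subset (e := d) ?_ hdQ)
    exact ZFSet.mem_sep.2 ⟨hdfin, b, hb, hbfin, fun x hx => (ZFSet.mem_sep.1 (hbY hx)).2⟩

/-- If a condition `r` contains a triple with model `M ∩ H_{κ⁺}`, then its trace `r ∩ M` belongs to
`M` and lies above `r`, and the models of `r` outside the trace all include `M ∩ H_{κ⁺}`. -/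
theorem inter_properties (hc : ContainsParameters κ I M) (hMc : (M : Set ZFSet.{u}).Countable)
    (hM : IsElementarySubmodel M H) (hI : IsPIdeal (cardSet κ) I) {r x a : ZFSet.{u}}
    (hr : r ∈ pidSet κ I) (hx : triple (M ∩ hSet (Order.succ κ)) x a ∈ r) :
    r ∩ M ∈ M ∧ PLe (pidRel κ I) r (r ∩ M) ∧
      ∀ N y b, triple N y b ∈ r → triple N y b ∉ r ∩ M → M ∩ hSet (Order.succ κ) ⊆ N := by
  have hrC := mem_pidSet.1 hr
  have hM0 := hM.inter hc.hSet_mem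
  have hsub : r ∩ M ⊆ r := fun z hz => (ZFSet.mem_inter.1 hz).1
  have key : ∀ N y b, triple N y b ∈ r → triple N y b ∉ r ∩ M →
      N = M ∩ hSet (Order.succ κ) ∨ M ∩ hSet (Order.succ κ) ∈ N := by
    intro N y b h hn
    by_cases heq : triple (M ∩ hSet (Order.succ κ)) x a = triple N y b
    · exact Or.inl (triple_inj.1 heq).1.symm
    · rcases hrC.2.2 _ _ _ _ _ _ hx h heq with h1 | ⟨h1, h2, h3⟩
      · exact Or.inr h1.1
      · refine (hn (ZFSet.mem_inter.2 ⟨h, ?_⟩)).elim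
        exact (ZFSet.mem_inter.1 (hM0.triple_mem h1 h2 h3)).1
  refine ⟨hM.finite_mem (hrC.1.subset (ZFSet.coe_subset_coe.2 hsub))
    fun z hz => (ZFSet.mem_inter.1 hz).2,
    ple_pidRel.2 ⟨hr, mem_pidSet.2 (hrC.subset hsub), hsub, ?_⟩, ?_⟩
  · intro N y b N' y' b' h hn h' hNN'
    exfalso
    have h1 : N' ∈ M ∩ hSet (Order.succ κ) := by
      have h2 := ZFSet.mem_inter.1 h'
      exact ZFSet.mem_inter.2 ⟨(hM.of_triple_mem h2.2).1,
        (IsPIDTriple.mem_hSet hI (hrC.isPIDTriple h2.1)).1⟩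
    have h3 := (ZFSet.rank_lt_of_mem hNN').trans (ZFSet.rank_lt_of_mem h1)
    rcases key N y b h hn with rfl | h4
    · exact lt_irrefl _ h3
    · exact lt_irrefl _ (h3.trans (ZFSet.rank_lt_of_mem h4))
  · intro N y b h hn
    rcases key N y b h hn with rfl | h4
    · exact fun _ h => h
    · refine (hrC.isPIDTriple h).1.2.subset_of_countable h4 (hMc.mono fun z hz => ?_)
      exact (ZFSet.mem_inter.1 hz).1

/-- The condition for goodness of a set `s ∈ M` over the trace of a condition `r ∈ s` holds for the
parameters `z ∈ M`: the trace family belongs to `M` and contains the set of new points of `r`, so it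
is unavoidable. -/
theorem exists_forall_isWitness (hκ : ℵ₀ ≤ κ) (hc : ContainsParameters κ I M)
    (hMc : (M : Set ZFSet.{u}).Countable)
    (hM : IsElementarySubmodel M H) (hI : IsPIdeal (cardSet κ) I) {s r x a : ZFSet.{u}}
    (hs : s ∈ M) (hrs : r ∈ s)
    (hr : r ∈ pidSet κ I) (hx : triple (M ∩ hSet (Order.succ κ)) x a ∈ r) {z : ZFSet.{u}}
    (hz : z ∈ M) (hzK : z ∈ hSet (Order.succ κ)) :
    ∃ b ∈ I, ∀ e ∈ finSubsets (cardSet κ), ∃ r' ∈ s, IsWitness κ I (r ∩ M) z b e r' := by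
  obtain ⟨hp₀, hrp, hrM⟩ := inter_properties hc hMc hM hI hr hx
  have hrC := mem_pidSet.1 hr
  have hfin : {t : ZFSet.{u} × ZFSet.{u} |
      ∃ b, triple t.1 t.2 b ∈ r ∧ triple t.1 t.2 b ∉ r ∩ M}.Finite := by
    refine ((finite_setOf_triple hrC.1).image fun t => (t.1, t.2.1)).subset ?_
    rintro ⟨N, y⟩ ⟨b, h, -⟩
    exact ⟨(N, y, b), h, rfl⟩
  let d : ZFSet.{u} := (cardSet κ).sep fun y => ∃ N b, triple N y b ∈ r ∧ triple N y b ∉ r ∩ M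
  have hd (y : ZFSet.{u}) : y ∈ d ↔ ∃ t ∈ hfin.toFinset, t.2 = y := by
    rw [ZFSet.mem_sep]
    constructor
    · rintro ⟨-, N, b, h, h'⟩
      exact ⟨(N, y), hfin.mem_toFinset.2 ⟨b, h, h'⟩, rfl⟩
    · rintro ⟨⟨N, y⟩, h, rfl⟩
      obtain ⟨b, h, h'⟩ := hfin.mem_toFinset.1 h
      exact ⟨(hrC.isPIDTriple h).2.1.1, N, b, h, h'⟩
  have hdA : d ∈ traceFamily κ I s (r ∩ M) z := by
    refine ZFSet.mem_sep.2 ⟨mem_finSubsets.2 ⟨ZFSet.sep_subset, ?_⟩, r, hrs, hrp, ?_⟩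
    · refine (hfin.image Prod.snd).subset fun y hy => ?_
      obtain ⟨t, ht, h⟩ := (hd y).1 hy
      exact ⟨t, hfin.mem_toFinset.1 ht, h⟩
    · intro N _ y _ b _ h h'
      exact ⟨hrM N y b h h' (ZFSet.mem_inter.2 ⟨hz, hzK⟩),
        ZFSet.mem_sep.2 ⟨(hrC.isPIDTriple h).2.1.1, N, b, h, h'⟩, ZFSet.notMem_empty _⟩
  have hun : IsUnavoidable (cardSet κ) I (traceFamily κ I s (r ∩ M) z) := by
    refine isUnavoidable_of_chain hκ hc hM hI hfin.toFinset (fun t ht => ?_)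
      (fun t ht t' ht' hne => ?_) (hc.traceFamily_mem hM hs hp₀ hz) ZFSet.sep_subset hdA hd
    · obtain ⟨b, h, h'⟩ := hfin.mem_toFinset.1 ht
      have h1 := hrC.isPIDTriple h
      exact ⟨h1.1, h1.2.1.2, hrM _ _ _ h h'⟩
    · obtain ⟨b, h, -⟩ := hfin.mem_toFinset.1 ht
      obtain ⟨b', h', -⟩ := hfin.mem_toFinset.1 ht'
      have hne' : triple t.1 t.2 b ≠ triple t'.1 t'.2 b' := fun h => by
        obtain ⟨h1, h2, -⟩ := triple_inj.1 h
        exact hne (Prod.ext h1 h2)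
      rcases hrC.2.2 _ _ _ _ _ _ h h' hne' with h1 | h1
      · exact Or.inl ⟨h1.1, h1.2.1⟩
      · exact Or.inr ⟨h1.1, h1.2.1⟩
  obtain ⟨b, hb, hbA⟩ := hun
  refine ⟨b, hb, fun e he => ?_⟩
  obtain ⟨d', hd', hdb, hde⟩ := hbA e he
  obtain ⟨-, r', hr's, hr'p, hr'⟩ := ZFSet.mem_sep.1 hd'
  refine ⟨r', hr's, hr'p, fun N hN y hy a ha h h' => ?_⟩
  obtain ⟨h1, h2, -⟩ := hr' N hN y hy a ha h h'
  exact ⟨h1, hdb h2, hde y h2⟩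

end

/-! ### Master conditions -/

section
variable {κ : Cardinal.{u}} {I H M : ZFSet.{u}} [hH : IsClosedUniverse H]
  [hK : IsClosedUniverse (hSet (Order.succ κ))]

/-- A condition that contains a triple with model `M ∩ H_{κ⁺}` is compatible with some element of
`D ∩ M`, for each dense set `D ∈ M`. -/
theorem exists_compatible (hκ : ℵ₀ ≤ κ) (hc : ContainsParameters κ I M)
    (hMc : (M : Set ZFSet.{u}).Countable)
    (hM : IsElementarySubmodel M H) (hI : IsPIdeal (cardSet κ) I) {D r x a : ZFSet.{u}}
    (hD : D ∈ M) (hDd : IsDenseSubset (pidSet κ I) (pidRel κ I) D)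
    (hr : r ∈ pidSet κ I) (hx : triple (M ∩ hSet (Order.succ κ)) x a ∈ r) :
    ∃ d ∈ D, d ∈ M ∧ Compatible (pidSet κ I) (pidRel κ I) d r := by
  obtain ⟨t, htD, htr⟩ := hDd.2 r hr
  have htx := (ple_pidRel.1 htr).2.2.1 hx
  have ht := hDd.1 htD
  obtain ⟨hp₀, htp, htM⟩ := inter_properties hc hMc hM hI ht htx
  have hKM {z : ZFSet.{u}} (hz : z ∈ hSet (Order.succ κ)) (hzM : z ∈ M) :
    z ∈ M ∩ hSet (Order.succ κ) := ZFSet.mem_inter.2 ⟨hzM, hz⟩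
  have hex : ∃ b ∈ H, b ∈ I ∧ ∀ e ∈ finSubsets (cardSet κ), ∃ r' ∈ D,
      IsWitness κ I (t ∩ M) ∅ b e r' := by
    obtain ⟨b, hb, h⟩ := exists_forall_isWitness hκ hc hMc hM hI hD htD ht htx hM.empty_mem hK.empty
    exact ⟨b, hH.trans _ (hM.subset hc.ideal_mem) _ hb, hb, h⟩
  obtain ⟨b, hbM, hb, hbD⟩ := hM.exists_mem (.and (.mem (.var _) (hM.const hc.ideal_mem))
    (.allMem (hM.const hc.finSubsets_mem) (.exMem (hM.const hD)
      (hc.isWitness hM (hM.const hp₀) .empty (.var _) (.var _) (.var _))))) hex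
  have he := sep_exists_notMem_mem_finSubsets (p₀ := t ∩ M) hI ht hb fun N y a h h' =>
    htM N y a h h' (hKM (hI.mem_hSet hb) hbM)
  set e := b.sep fun x => ∃ N y a, triple N y a ∈ t ∧ triple N y a ∉ t ∩ M ∧ x ∉ a with he'
  have heM : e ∈ M := hM.finite_mem (mem_finSubsets.1 he).2 fun z hz =>
    hM.subset_of_countable hbM (hI.countable b hb).2 (ZFSet.mem_sep.1 hz).1
  have hex' : ∃ d ∈ H, d ∈ D ∧ IsWitness κ I (t ∩ M) ∅ b e d := by
    obtain ⟨d, hd, h⟩ := hbD e he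
    exact ⟨d, hH.trans _ (hM.subset hD) _ hd, hd, h⟩
  obtain ⟨d, hdM, hd, hdp, hdw⟩ := hM.exists_mem (.and (.mem (.var _) (hM.const hD))
    (hc.isWitness hM (hM.const hp₀) .empty (hM.const hbM) (hM.const heM) (.var _))) hex'
  obtain ⟨hu1, hu2⟩ := union_ple htp hdp (fun N y a h h' =>
    htM N y a h h' (hKM (mem_hSet_of_mem_pidSet hI (hDd.1 hd)) hdM)) <| by
      intro N y a N' y' a' h1 h2 h3 h4
      obtain ⟨h5, h6, h7⟩ := IsPIDTriple.mem_hSet hI ((mem_pidSet.1 (hDd.1 hd)).isPIDTriple h3)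
      obtain ⟨-, h8, h9⟩ := hdw N' h5 y' h6 a' h7 h3 h4
      by_contra h10
      exact h9 (ZFSet.mem_sep.2 ⟨h8, N, y, a, h1, h2, h10⟩)
  exact ⟨d, hd, hdM, t ∪ d, (ple_pidRel.1 hu1).1, hu2, hu1.trans htr⟩

/-- A set `s ∈ M` of conditions is good over the trace on `M` of any `r ∈ s` that contains a triple
with model `M ∩ H_{κ⁺}`. By elementarity it is enough to consider parameters in `M`. -/
theorem isGood_of_mem (hκ : ℵ₀ ≤ κ) (hc : ContainsParameters κ I M)
    (hMc : (M : Set ZFSet.{u}).Countable)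
    (hM : IsElementarySubmodel M H) (hI : IsPIdeal (cardSet κ) I) {s r x a : ZFSet.{u}}
    (hs : s ∈ M) (hrs : r ∈ s)
    (hr : r ∈ pidSet κ I) (hx : triple (M ∩ hSet (Order.succ κ)) x a ∈ r) :
    IsGood κ I s (r ∩ M) := by
  have hp₀ := (inter_properties hc hMc hM hI hr hx).1
  by_contra hcon
  have hex : ∃ z ∈ H, z ∈ hSet (Order.succ κ) ∧ ¬ ∃ b ∈ I, ∀ e ∈ finSubsets (cardSet κ),
      ∃ r' ∈ s, IsWitness κ I (r ∩ M) z b e r' := by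
    unfold IsGood at hcon
    push Not at hcon ⊢
    obtain ⟨z, hz, h⟩ := hcon
    exact ⟨z, hH.trans _ (hM.subset hc.hSet_mem) _ hz, hz, h⟩
  obtain ⟨z, hzM, hz, h⟩ := hM.exists_mem (.and (.mem (.var _) (hM.const hc.hSet_mem))
    (.not (.exMem (hM.const hc.ideal_mem) (.allMem (hM.const hc.finSubsets_mem)
      (.exMem (hM.const hs)
        (hc.isWitness hM (hM.const hp₀) (.var _) (.var _) (.var _) (.var _))))))) hex
  exact h (exists_forall_isWitness hκ hc hMc hM hI hs hrs hr hx hzM hz)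

/-- The good regular open sets generate a proper filter on `RO(P)`. -/
theorem exists_isFilterRO_isGood (hI : IsPIdeal (cardSet κ) I) {p₀ : ZFSet.{u}}
    (hp₀ : p₀ ∈ pidSet κ I) : ∃ F, IsFilterRO (pidSet κ I) (pidRel κ I) F ∧
      ∀ s ∈ roSet (pidSet κ I) (pidRel κ I), IsGood κ I s p₀ → s ∈ F := by
  let G : ZFSet.{u} → Prop := fun s => s ∈ roSet (pidSet κ I) (pidRel κ I) ∧ IsGood κ I s p₀
  have hG (l : List ZFSet.{u}) (hl : ∀ s ∈ l, G s) : ∃ r ∈ pidSet κ I, ∀ s ∈ l, r ∈ s := by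
    obtain ⟨r, hr, h, -⟩ := exists_mem_of_isGood hI hp₀ l (fun s hs => (hl s hs).2)
      (fun s hs => ⟨(mem_roSet.1 (hl s hs).1).1, fun p hp q hq =>
        (mem_roSet.1 (hl s hs).1).mem_of_ple hp hq⟩) hK.empty
    exact ⟨r, (ple_pidRel.1 hr).1, h⟩
  let F : ZFSet.{u} := (roSet (pidSet κ I) (pidRel κ I)).sep fun V =>
    ∃ l : List ZFSet.{u}, (∀ s ∈ l, G s) ∧ ∀ r ∈ pidSet κ I, (∀ s ∈ l, r ∈ s) → r ∈ V
  refine ⟨F, ⟨ZFSet.sep_subset, ⟨pidSet κ I, ?_⟩, ?_, ?_, ?_⟩, ?_⟩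
  · refine ZFSet.mem_sep.2
      ⟨mem_roSet.2 ⟨fun _ h => h, fun p hp => ⟨fun _ q hq _ => ?_, fun _ => hp⟩⟩, [], by simp,
        fun r hr _ => hr⟩
    exact ⟨q, hq, PLe.refl hq⟩
  · intro h
    obtain ⟨-, l, hl, h⟩ := ZFSet.mem_sep.1 h
    obtain ⟨r, hr, hrl⟩ := hG l hl
    exact ZFSet.notMem_empty _ (h r hr hrl)
  · intro U hU V hV hUV
    obtain ⟨-, l, hl, h⟩ := ZFSet.mem_sep.1 hU
    exact ZFSet.mem_sep.2 ⟨hV, l, hl, fun r hr hrl => hUV (h r hr hrl)⟩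
  · intro U hU V hV
    obtain ⟨hU', l, hl, h⟩ := ZFSet.mem_sep.1 hU
    obtain ⟨hV', l', hl', h'⟩ := ZFSet.mem_sep.1 hV
    refine ZFSet.mem_sep.2 ⟨mem_roSet.2 ((mem_roSet.1 hU').inter (mem_roSet.1 hV')),
      l ++ l', ?_, ?_⟩
    · intro s hs
      exact (List.mem_append.1 hs).elim (hl s) (hl' s)
    · intro r hr hrl
      exact ZFSet.mem_inter.2 ⟨h r hr fun s hs => hrl s (List.mem_append_left _ hs),
        h' r hr fun s hs => hrl s (List.mem_append_right _ hs)⟩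
  · intro s hs hgood
    exact ZFSet.mem_sep.2 ⟨hs, [s], by simpa using ⟨hs, hgood⟩, fun r _ h => h s (by simp)⟩

/-- By elementarity, `M` contains a filter on `RO(P)` to which all good regular open sets belong. -/
theorem exists_filter_mem (hc : ContainsParameters κ I M) (hM : IsElementarySubmodel M H)
    (hI : IsPIdeal (cardSet κ) I) {p₀ : ZFSet.{u}}
    (hp₀ : p₀ ∈ pidSet κ I) (hp₀M : p₀ ∈ M) :
    ∃ F ∈ M, IsFilterRO (pidSet κ I) (pidRel κ I) F ∧
      ∀ s ∈ roSet (pidSet κ I) (pidRel κ I), IsGood κ I s p₀ → s ∈ F := by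
  have hex : ∃ F ∈ H, IsFilterRO (pidSet κ I) (pidRel κ I) F ∧
      ∀ s ∈ roSet (pidSet κ I) (pidRel κ I), IsGood κ I s p₀ → s ∈ F := by
    obtain ⟨F, hF, h⟩ := exists_isFilterRO_isGood hI hp₀
    exact ⟨F, hH.subset _ (hM.subset hc.roSet_mem) _ hF.subset, hF, h⟩
  refine hM.exists_mem (.and ?_ ?_) hex
  · refine DefinableRel.congr (φ := fun v => v 0 ⊆ roSet (pidSet κ I) (pidRel κ I) ∧
      (∃ U ∈ v 0, True) ∧ ¬ ∅ ∈ v 0 ∧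
      (∀ U ∈ v 0, ∀ V ∈ roSet (pidSet κ I) (pidRel κ I), U ⊆ V → V ∈ v 0) ∧
      ∀ U ∈ v 0, ∀ V ∈ v 0, ∃ W ∈ v 0, (W ⊆ U ∧ W ⊆ V) ∧ ∀ p ∈ U, p ∈ V → p ∈ W)
      (.and (.subset (.var _) (hM.const hc.roSet_mem)) (.and (.exMem (.var _) (.const True))
        (.and (.not (.mem .empty (.var _))) (.and (.allMem (.var _)
          (.allMem (hM.const hc.roSet_mem) (.imp (.subset (.var _) (.var _))
            (.mem (.var _) (.var _))))) (.allMem (.var _) (.allMem (.var _) (.exMem (.var _)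
              (.and (.and (.subset (.var _) (.var _)) (.subset (.var _) (.var _)))
                (.allMem (.var _) (.imp (.mem (.var _) (.var _))
                  (.mem (.var _) (.var _)))))))))))) fun v _ => ?_
    constructor
    · rintro ⟨h1, ⟨U, hU, -⟩, h3, h4, h5⟩
      refine ⟨h1, ⟨U, hU⟩, h3, h4, fun U hU V hV => ?_⟩
      obtain ⟨W, hW, ⟨h6, h7⟩, h8⟩ := h5 U hU V hV
      have : U ∩ V = W := by
        ext p
        rw [ZFSet.mem_inter]
        exact ⟨fun h => h8 p h.1 h.2, fun h => ⟨h6 h, h7 h⟩⟩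
      rwa [this]
    · rintro ⟨h1, ⟨U, hU⟩, h3, h4, h5⟩
      refine ⟨h1, ⟨U, hU, trivial⟩, h3, h4, fun U hU V hV => ⟨U ∩ V, h5 U hU V hV, ⟨?_, ?_⟩, ?_⟩⟩
      · exact fun p hp => (ZFSet.mem_inter.1 hp).1
      · exact fun p hp => (ZFSet.mem_inter.1 hp).2
      · exact fun p h h' => ZFSet.mem_inter.2 ⟨h, h'⟩
  · exact .allMem (hM.const hc.roSet_mem) (.imp (.allMem (hM.const hc.hSet_mem)
      (.exMem (hM.const hc.ideal_mem) (.allMem (hM.const hc.finSubsets_mem) (.exMem (.var _)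
        (hc.isWitness hM (hM.const hp₀M) (.var _) (.var _) (.var _) (.var _))))))
      (.mem (.var _) (.var _)))

/-- Every condition that contains a triple with model `M ∩ H_{κ⁺}` is a Y-master condition for
`M`. -/
theorem isYMaster_of_mem (hκ : ℵ₀ ≤ κ) (hc : ContainsParameters κ I M)
    (hMc : (M : Set ZFSet.{u}).Countable)
    (hM : IsElementarySubmodel M H) (hI : IsPIdeal (cardSet κ) I) {q x a : ZFSet.{u}}
    (hx : triple (M ∩ hSet (Order.succ κ)) x a ∈ q) :
    IsYMaster (pidSet κ I) (pidRel κ I) M q := by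
  refine ⟨fun D hD hDd r hr hrq => ?_, fun r hr hrq => ?_⟩
  · exact exists_compatible hκ hc hMc hM hI hD hDd hr ((ple_pidRel.1 hrq).2.2.1 hx)
  · have hrx := (ple_pidRel.1 hrq).2.2.1 hx
    obtain ⟨hp₀M, hrp, -⟩ := inter_properties hc hMc hM hI hr hrx
    obtain ⟨F, hFM, hF, hFG⟩ := exists_filter_mem hc hM hI (ple_pidRel.1 hrp).2.1 hp₀M
    exact ⟨F, hFM, hF, fun s hs hsM hrs =>
      hFG s hs (isGood_of_mem hκ hc hMc hM hI hsM (hrs (mem_roEmbed hr)) hr hrx)⟩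

/-- A condition in `M` can be extended by a triple with model `M ∩ H_{κ⁺}`. -/
theorem exists_ple_triple_mem (hc : ContainsParameters κ I M) (hMc : (M : Set ZFSet.{u}).Countable)
    (hM : IsElementarySubmodel M H) (hI : IsPIdeal (cardSet κ) I)
    (hX : ¬ ∃ Y : ℕ → ZFSet.{u}, (∀ n, IsOrthogonal (cardSet κ) I (Y n)) ∧
      (cardSet κ : Set ZFSet.{u}) = ⋃ n, (Y n : Set ZFSet.{u}))
    {p : ZFSet.{u}} (hp : p ∈ pidSet κ I) (hpM : p ∈ M) :
    ∃ q ∈ pidSet κ I, PLe (pidRel κ I) q p ∧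
      ∃ x a, triple (M ∩ hSet (Order.succ κ)) x a ∈ q := by
  have hpC := mem_pidSet.1 hp
  have hM₀ : IsCountableSubmodel (M ∩ hSet (Order.succ κ)) (hSet (Order.succ κ)) :=
    ⟨hMc.mono fun z hz => (ZFSet.mem_inter.1 hz).1, hM.inter hc.hSet_mem⟩
  obtain ⟨x, a, hxa, -⟩ := exists_isPIDTriple hI hX hM₀ hI.empty_mem
  have key : ∀ N y b, triple N y b ∈ p → N ∈ M ∩ hSet (Order.succ κ) ∧
      y ∈ M ∩ hSet (Order.succ κ) ∧ b ∈ M ∩ hSet (Order.succ κ) := by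
    intro N y b h
    obtain ⟨h1, h2, h3⟩ := hM.of_triple_mem (hM.subset_of_countable hpM hpC.1.countable h)
    obtain ⟨h4, h5, h6⟩ := IsPIDTriple.mem_hSet hI (hpC.isPIDTriple h)
    exact ⟨ZFSet.mem_inter.2 ⟨h1, h4⟩, ZFSet.mem_inter.2 ⟨h2, h5⟩, ZFSet.mem_inter.2 ⟨h3, h6⟩⟩
  have hq : insert (triple (M ∩ hSet (Order.succ κ)) x a) p ∈ pidSet κ I := by
    refine mem_pidSet.2 ⟨?_, fun t ht => ?_, ?_⟩
    · rw [ZFSet.coe_insert]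
      exact hpC.1.insert _
    · rcases ZFSet.mem_insert_iff.1 ht with rfl | ht
      exacts [⟨_, _, _, rfl, hxa⟩, hpC.2.1 t ht]
    · intro N y b N' y' b' h h' hne
      rcases ZFSet.mem_insert_iff.1 h with h | h <;> rcases ZFSet.mem_insert_iff.1 h' with h' | h'
      · exact (hne (h.trans h'.symm)).elim
      · rw [(triple_inj.1 h).1]
        exact Or.inr (key _ _ _ h')
      · rw [(triple_inj.1 h').1]
        exact Or.inl (key _ _ _ h)
      · exact hpC.2.2 _ _ _ _ _ _ h h' hne
  refine ⟨_, hq, ple_pidRel.2 ⟨hq, hp, fun z hz => ZFSet.mem_insert_of_mem _ hz, ?_⟩, x, a,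
    ZFSet.mem_insert _ _⟩
  intro N y b N' y' b' h hn h' hNN'
  obtain ⟨rfl, rfl, rfl⟩ := triple_inj.1 ((ZFSet.mem_insert_iff.1 h).resolve_right hn)
  exact (ZFSet.mem_asymm hNN' (key _ _ _ h').1).elim

end

/-- If `κ` is not a countable union of orthogonal sets, then it is infinite, because finite sets are
orthogonal. -/
theorem IsPIdeal.aleph0_le {κ : Cardinal.{u}} {I : ZFSet.{u}} (hI : IsPIdeal (cardSet κ) I)
    (hX : ¬ ∃ Y : ℕ → ZFSet.{u}, (∀ n, IsOrthogonal (cardSet κ) I (Y n)) ∧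
      (cardSet κ : Set ZFSet.{u}) = ⋃ n, (Y n : Set ZFSet.{u})) : ℵ₀ ≤ κ := by
  by_contra! hκ
  have hfin : (cardSet κ : Set ZFSet.{u}).Finite := by
    rw [← lt_aleph0_iff_set_finite]
    refine (@ZFSet.cardinalMk_coe_sort (cardSet κ)).trans_lt ?_
    rw [cardSet, Ordinal.card_toZFSet, card_ord]
    simpa using hκ
  refine hX ⟨fun _ => cardSet κ, fun _ => hI.isOrthogonal_of_finite
    (mem_finSubsets.2 ⟨fun _ h => h, hfin⟩), ?_⟩
  exact (Set.iUnion_const _).symm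

end PIDForcing

theorem mainTheorem10 (κ : Cardinal.{u}) (I : ZFSet.{u})
    (hI : PIDForcing.IsPIdeal (PIDForcing.cardSet κ) I)
    (hX : ¬ ∃ Y : ℕ → ZFSet.{u}, (∀ n, PIDForcing.IsOrthogonal (PIDForcing.cardSet κ) I (Y n)) ∧
      (PIDForcing.cardSet κ : Set ZFSet.{u}) = ⋃ n, (Y n : Set ZFSet.{u})) :
    PIDForcing.YProper (PIDForcing.pidSet κ I) (PIDForcing.pidRel κ I) := by
  have hκ := hI.aleph0_le hX
  have hK := PIDForcing.isClosedUniverse_hSet (Cardinal.isRegular_succ hκ) (Order.lt_succ_of_le hκ)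
  obtain ⟨θ₀, hθ₀⟩ := PIDForcing.exists_mem_hSet
    (PIDForcing.hSet (Order.succ κ)).powerset
  -- The sets `H_{κ⁺}`, `I`, `κ` and `RO(P)` are members or subsets of the power set of `H_{κ⁺}`,
  -- so `θ` is large enough once this power set belongs to `H_θ`.
  refine ⟨max θ₀ (Order.succ κ), fun θ hθ hreg M hM hPR p hp hpM => ?_⟩
  have hH := PIDForcing.isClosedUniverse_hSet hreg
    ((Order.lt_succ_of_le hκ).trans_le ((le_max_right _ _).trans hθ))
  have hbig := hθ₀ θ ((le_max_left _ _).trans hθ)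
  have hc := PIDForcing.containsParameters hκ hM.2 hI hX hbig hPR
  obtain ⟨q, hq, hqp, x, a, hx⟩ := PIDForcing.exists_ple_triple_mem hc hM.1 hM.2 hI hX hp hpM
  exact ⟨q, hq, hqp, PIDForcing.isYMaster_of_mem hκ hc hM.1 hM.2 hI hx⟩
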